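/- **Notation.** For a monic polynomial $p$ of degree $d$ write $p(x)=\sum_{i=0}^d(-1)^i\binom di\widetilde a_i(p)x^{d-i}$. Put $$(p\boxtimes_d q)(x)=\sum_{i=0}^d(-1)^i\tbinom di\widetilde a_i(p)\widetilde a_i(q)x^{d-i},\qquad (p\boxplus_d q)(x)=\sum_{k=0}^d(-1)^k\tbinom dk\sum_{i+j=k}\tfrac{k!}{i!j!}\widetilde a_i(p)\widetilde a_j(q)x^{d-k},$$ let $p^{\boxtimes_d m},p^{\boxplus_d m}$ be the $m$-fold powers, $D_c(p)(x)=c^dp(x/c)$ for $c\ne0$, and, for $1\le n\le d$, $$\kappa_n^{(d)}(p)=\frac{(-d)^{n-1}}{(n-1)!}\sum_{\pi\in\mathcal P(n)}\Big(\prod_{V\in\pi}\widetilde a_{|V|}(p)\Big)(-1)^{|\pi|-1}(|\pi|-1)!,$$ where $\mathcal P(n)$ is the set of partitions of $\{1,\dots,n\}$ and $|\pi|$ is the number of blocks of $\pi$. If $p$ has real roots $\lambda_1,\dots,\lambda_d$, then $\mu[\![p]\!]=\frac1d\sum_k\delta_{\lambda_k}$. For a probability measure $\rho$ on $\mathbb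 R$ with all moments, $m_k(\rho)$ is its $k$-th moment and $\kappa_n(\rho)$ its $n$-th free cumulant (so $\kappa_2$ is the variance). Free additive and multiplicative convolution of measures are $\boxplus$ and $\boxtimes$, and $D_c(\rho)$ is the image of $\rho$ under $x\mapsto cx$. For $\alpha\ge0$ the Sakuma–Yoshida limit $\eta_\alpha$ is the weak limit, as $m\to\infty$, of $D_{s^m/m}\big((\nu^{\boxtimes m})^{\boxplus m}\big)$, where $\nu\neq\delta_0$ is a compactly supported probability measure on $[0,\infty)$ with $\operatorname{Var}(\nu)/m_1(\nu)^2=\alpha$ and $s=1/m_1(\nu)$. **Theorem.** For every $d\ge1$ let $p_d$ be a monic polynomial of degree $d$ with nonnegative roots and $\kappa_1^{(d)}(p_d)=1$, and let $\mu$ be a compactly supported probability measure on $\mathbb R$. Suppose that, as $d\to\infty$, $\mu[\![p_d]\!]\to\mu$ weakly and with convergence of all moments, i.e. $m_k(\mu[\![p_d]\!])\to m_k(\mu)$ for every $k\in\mathbb N$. Then for every $n\ge1$ $$\lim_{\substack{d,m\to\infty\\ m/d\to0}}\kappa_n^{(d)}\Big(D_{1/m}\big((p_d^{\boxtimes_d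 m})^{\boxplus_d m}\big)\Big)=\frac{(\kappa_2(\mu)\,n)^{n-1}}{n!}.$$ Moreover, this limit is the $n$-th free cumulant of the Sakuma–Yoshida limit: if $\eta$ is the weak limit described above for $\alpha=\kappa_2(\mu)$ and any $\nu$ as above, then $\eta$ has moments of all orders and $\kappa_n(\eta)=(\kappa_2(\mu)n)^{n-1}/n!$ for every $n\ge1$. (Here $0^0=1$.) -/

import Mathlib

open Filter Topology MeasureTheory

noncomputable section

/-! ### Finite free probability

Throughout, a polynomial is regarded as an element of the set of monic polynomials of degree `d`,
and `d` is passed explicitly. -/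

namespace FiniteFree

open Polynomial

/-- `p` is monic of degree `d` and all its (complex) roots are nonnegative real numbers. Such a
polynomial automatically has real coefficients, so it is taken in `ℝ[X]`. -/
structure IsMonicNonnegRooted (d : ℕ) (p : ℝ[X]) : Prop where
  monic : p.Monic
  natDegree_eq : p.natDegree = d
  splits : p.Splits
  roots_nonneg : ∀ x ∈ p.roots, 0 ≤ x

/-- The normalized coefficient `ã_i(p) = (-1)^i (d choose i)⁻¹ a_i`, where `a_i` is the coefficient
of `x^(d-i)` in `p`; thus `p(x) = ∑ i, (-1)^i (d choose i) ã_i(p) x^(d-i)`. Used for `i ≤ d`. -/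
def normCoeff (d : ℕ) (p : ℝ[X]) (i : ℕ) : ℝ :=
  (-1) ^ i * ((d.choose i : ℕ) : ℝ)⁻¹ * p.coeff (d - i)

/-- The finite free additive convolution `p ⊞_d q`. -/
def addConv (d : ℕ) (p q : ℝ[X]) : ℝ[X] :=
  ∑ k ∈ Finset.range (d + 1),
    C ((-1) ^ k * (d.choose k : ℝ) *
      ∑ ij ∈ Finset.HasAntidiagonal.antidiagonal k,
        ((k.factorial : ℝ) / ((ij.1.factorial : ℝ) * (ij.2.factorial : ℝ))) *
          normCoeff d p ij.1 * normCoeff d q ij.2) * X ^ (d - k)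

/-- The finite free multiplicative convolution `p ⊠_d q`. -/
def mulConv (d : ℕ) (p q : ℝ[X]) : ℝ[X] :=
  ∑ i ∈ Finset.range (d + 1),
    C ((-1) ^ i * (d.choose i : ℝ) * normCoeff d p i * normCoeff d q i) * X ^ (d - i)

/-- The power `p^{⊞_d m}`; the zeroth power is the neutral element `x^d` of `⊞_d`. -/
def addConvPow (d : ℕ) (p : ℝ[X]) : ℕ → ℝ[X]
  | 0 => X ^ d
  | m + 1 => addConv d (addConvPow d p m) p

/-- The power `p^{⊠_d m}`; the zeroth power is the neutral element `(x-1)^d` of `⊠_d`. -/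
def mulConvPow (d : ℕ) (p : ℝ[X]) : ℕ → ℝ[X]
  | 0 => (X - 1) ^ d
  | m + 1 => mulConv d (mulConvPow d p m) p

/-- The dilation `D_c(p)(x) = c^d p(x/c)`, for `c ≠ 0`. -/
def dilate (d : ℕ) (c : ℝ) (p : ℝ[X]) : ℝ[X] :=
  C (c ^ d) * p.comp (C c⁻¹ * X)

/-- The value `μ_n(π, 1_n) = (-1)^(|π|-1) (|π|-1)!` of the Möbius function of the lattice of all
partitions of `{1, …, n}`, where `1_n` is the one-block partition. -/
def moebiusTop {n : ℕ} (π : Finpartition (Finset.univ : Finset (Fin n))) : ℝ :=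
  (-1) ^ (π.parts.card - 1) * ((π.parts.card - 1).factorial : ℝ)

/-- The finite free cumulant
`κ_n^{(d)}(p) = (-d)^(n-1) / (n-1)! * ∑_{π ∈ P(n)} ã_π(p) μ_n(π, 1_n)`, with
`ã_π = ∏_{V ∈ π} ã_{|V|}`. Meaningful for `1 ≤ n ≤ d`. -/
def cumulant (d n : ℕ) (p : ℝ[X]) : ℝ :=
  (-(d : ℝ)) ^ (n - 1) / ((n - 1).factorial : ℝ) *
    ∑ π : Finpartition (Finset.univ : Finset (Fin n)),
      (∏ V ∈ π.parts, normCoeff d p V.card) * moebiusTop π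

/-- The empirical root distribution `μ⟦p⟧ = (1/d) ∑ δ_{λ_k}` of a polynomial of degree `d` with
only real roots `λ_1, …, λ_d` (listed with multiplicity). -/
def empiricalRootMeasure (d : ℕ) (p : ℝ[X]) : Measure ℝ :=
  (d : ENNReal)⁻¹ • (p.roots.map Measure.dirac).sum

end FiniteFree

/-! ### Free probability -/

namespace FreeProb

/-- Weak convergence of (probability) measures on `ℝ`, tested on bounded continuous functions. -/
def WeakTendsto {ι : Type*} (ρ : ι → Measure ℝ) (l : Filter ι) (μ : Measure ℝ) : Prop :=
  ∀ f : BoundedContinuousFunction ℝ ℝ,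
    Tendsto (fun i => ∫ x, f x ∂(ρ i)) l (𝓝 (∫ x, f x ∂μ))

/-- `μ` is carried by some compact set. -/
def CompactlySupported (μ : Measure ℝ) : Prop :=
  ∃ K : Set ℝ, IsCompact K ∧ μ Kᶜ = 0

/-- The moment `m_n(μ)`. -/
def moment (μ : Measure ℝ) (n : ℕ) : ℝ := ∫ x, x ^ n ∂μ

/-- The moment generating series `M_μ(z) = ∑ m_n(μ) z^n`. -/
def momentSeries (μ : Measure ℝ) : PowerSeries ℝ := PowerSeries.mk (moment μ)

/-- The free cumulants `κ_n(μ)`, `n ≥ 1`, of a probability measure with moments of all orders,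
defined by the free moment-cumulant relation `M(z) = 1 + ∑_{s ≥ 1} κ_s (z M(z))^s`, i.e.
`m_n = ∑_{s=1}^n κ_s [z^(n-s)] M(z)^s`
(`= ∑_{s=1}^n κ_s ∑_{i_1 + … + i_s = n - s} m_{i_1} ⋯ m_{i_s}`), which is solved recursively
for `κ_n`, the term `s = n` being `κ_n`. By convention `κ_0 = 0`. -/
def freeCumulant (μ : Measure ℝ) : ℕ → ℝ
  | 0 => 0
  | n + 1 => moment μ (n + 1) -
      ∑ s : Fin n, freeCumulant μ (s + 1) *
        PowerSeries.coeff (n - s) (momentSeries μ ^ ((s : ℕ) + 1))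
  decreasing_by exact Nat.succ_lt_succ s.isLt

/-- The R-transform `R_μ(z) = ∑_{n ≥ 1} κ_n(μ) z^n`, as a formal power series. -/
def RTransform (μ : Measure ℝ) : PowerSeries ℝ := PowerSeries.mk (freeCumulant μ)

/-- `S` is the S-transform of `μ`: `R_μ(z S(z)) = z` as formal power series. If `m_1(μ) ≠ 0` there
is exactly one such `S`; if `m_1(μ) = 0` there is none. -/
def IsSTransform (μ : Measure ℝ) (S : PowerSeries ℝ) : Prop :=
  (RTransform μ).subst (PowerSeries.X * S) = PowerSeries.X

/-- A compactly supported probability measure on `ℝ`. -/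
structure IsCompactProb (μ : Measure ℝ) : Prop where
  prob : IsProbabilityMeasure μ
  compact : CompactlySupported μ

/-- `ρ = μ ⊞ ν` for compactly supported probability measures: `R_ρ = R_μ + R_ν`. -/
structure IsFreeAddConv (μ ν ρ : Measure ℝ) : Prop where
  left : IsCompactProb μ
  right : IsCompactProb ν
  conv : IsCompactProb ρ
  rTransform : RTransform ρ = RTransform μ + RTransform ν

/-- A compactly supported probability measure on `[0, ∞)` other than `δ_0`. -/
structure IsCompactProbNonneg (μ : Measure ℝ) : Prop extends IsCompactProb μ where
  nonneg : μ (Set.Iio 0) = 0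
  ne_dirac : μ ≠ Measure.dirac 0

/-- `ρ = μ ⊠ ν` for compactly supported probability measures on `[0, ∞)` other than `δ_0`:
`S_ρ = S_μ S_ν`. -/
structure IsFreeMulConv (μ ν ρ : Measure ℝ) : Prop where
  left : IsCompactProbNonneg μ
  right : IsCompactProbNonneg ν
  conv : IsCompactProbNonneg ρ
  sTransform : ∃ S T : PowerSeries ℝ,
    IsSTransform μ S ∧ IsSTransform ν T ∧ IsSTransform ρ (S * T)

/-- `ρ = μ^{⊞ m}`; the zeroth power is `δ_0`. -/
def IsFreeAddPow (μ : Measure ℝ) : ℕ → Measure ℝ → Prop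
  | 0, ρ => ρ = Measure.dirac 0
  | m + 1, ρ => ∃ τ, IsFreeAddPow μ m τ ∧ IsFreeAddConv τ μ ρ

/-- `ρ = μ^{⊠ m}`; the zeroth power is `δ_1`. -/
def IsFreeMulPow (μ : Measure ℝ) : ℕ → Measure ℝ → Prop
  | 0, ρ => ρ = Measure.dirac 1
  | m + 1, ρ => ∃ τ, IsFreeMulPow μ m τ ∧ IsFreeMulConv τ μ ρ

/-- The dilation of a measure: the law of `c X` when `X` has law `μ`. -/
def dilateMeasure (c : ℝ) (μ : Measure ℝ) : Measure ℝ := μ.map (fun x => c * x)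

/-- `η` is a Sakuma–Yoshida limit with parameter `α`: it is the weak limit, as `m → ∞`, of
`D_{s^m/m}((ν^{⊠ m})^{⊞ m})` for some compactly supported probability measure `ν ≠ δ_0` on
`[0, ∞)` with `Var(ν) / m_1(ν)^2 = α`, where `s = 1 / m_1(ν)`. -/
def IsSakumaYoshidaLimit (α : ℝ) (η : Measure ℝ) : Prop :=
  IsProbabilityMeasure η ∧
  ∃ ν : Measure ℝ, IsCompactProbNonneg ν ∧
    (moment ν 2 - moment ν 1 ^ 2) / moment ν 1 ^ 2 = α ∧
    ∃ σ ρ : ℕ → Measure ℝ,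
      (∀ m, 1 ≤ m → IsFreeMulPow ν m (σ m)) ∧
      (∀ m, 1 ≤ m → IsFreeAddPow (σ m) m (ρ m)) ∧
      WeakTendsto (fun m : ℕ => dilateMeasure ((1 / moment ν 1) ^ m / (m : ℝ)) (ρ m)) atTop η

end FreeProb

/-- The regime `d, m → ∞` with `m / d → 0`, as a filter on pairs `(d, m)`. -/
def sparseRegime : Filter (ℕ × ℕ) :=
  (atTop ×ˢ atTop) ⊓ comap (fun q : ℕ × ℕ => (q.2 : ℝ) / (q.1 : ℝ)) (𝓝 0)

end

/-! Let ã_i be the normalized coefficients of p_d. They multiply under ⊠, and their exponential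
generating functions multiply under ⊞. Hence the cumulant of order n + 1 in question is (-1)^n / n!
· x_n / ε^n, where ε = m/d and x_n is the formal cumulant of the sequence b_i = ã_i^m, determined by
b_{n+1} = ∑ C(n,k) x_k b_{n-k}. With κ = κ_2(μ), it must be shown that x_n / ε^n → (-κ)^n
(n+1)^(n-1).

Smoothness in i/d. By Newton's identities the sequence (d)_i d^{-i} ã_i has the formal cumulants
(-1)^k k! m_{k+1} d^{-k}. From their order d^{-k} alone, `SmallCumulants.exists_hasSymbol_ratio`
deduces that the consecutive ratios behave like a power series in i/d: their k-th differences at 0,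
multiplied by d^k, converge. This notion is `HasSymbol`. It passes to ρ_i = log(ã_{i+1}/ã_i), whose
symbol starts with -κX. The k-th difference of mρ is of order m d^{-k} = ε^k m^(1-k), so at scale ε
only the linear term survives (`HasSymbol.zoom`). Thus b_j / b_{j+k+1} behaves like exp(κ(k+1)εj).

Inversion. Divide the recursion by b_{n+1} and take the n-th difference at 0. The left side becomes
1 or 0, and the right side ∑ C(n,k) x_k Δ^{n-k}(b_j/b_{j+k+1})(0). After division by ε^n, the limits
y_k of x_k/ε^k are forced to satisfy ∑ C(n,k) y_k (κ(k+1))^(n-k) = 0 for n ≥ 1. The claimed values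
solve this because the n-th difference of a polynomial of degree n - 1 vanishes
(`tendsto_cumulant_of_fwdDiff`).

Free side. If S is the S-transform of ν and G = S/S(0), then the R-transform Q of the m-th dilated
measure satisfies Q(z G(z/m)^m) = z. Since G(z/m)^m → e^{-αz}, the coefficients of Q tend to those
of the inverse of z e^{-αz}, the tree function. Convergence of cumulants gives convergence of
moments, and these bounds make the moments, hence the cumulants, pass to the weak limit. -/

open Filter Topology MeasureTheory

noncomputable section

/-! ### Set partitions, exponential generating functions and formal cumulants -/

section

namespace SetPartition

open Finset

variable {α : Type*} [DecidableEq α]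

/-- The partitions of `s` with a prescribed block `B` are the partitions of `s \ B`. -/
theorem sum_filter_mem_parts {s B : Finset α} (hB : B ⊆ s) (hne : B.Nonempty)
    (a : ℕ → ℝ) (φ : ℕ → ℝ) :
    ∑ π : Finpartition s with B ∈ π.parts, (∏ V ∈ π.parts, a V.card) * φ π.parts.card =
      a B.card * ∑ π : Finpartition (s \ B), (∏ V ∈ π.parts, a V.card) * φ (π.parts.card + 1) := by
  classical
  have hd : ∀ π : Finpartition (s \ B), B ∉ π.parts := fun π h => by
    obtain ⟨x, hx⟩ := hne
    exact (Finset.mem_sdiff.1 (π.subset h hx)).2 hx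
  have hav : ∀ π : Finpartition s, B ∈ π.parts → (π.avoid B).parts = π.parts.erase B := by
    intro π hπ
    ext V
    simp only [Finpartition.mem_avoid, Finset.mem_erase]
    constructor
    · rintro ⟨D, hD, hDB, rfl⟩
      have hne' : D ≠ B := fun h => hDB (h ▸ le_rfl)
      have : Disjoint D B := π.disjoint hD hπ hne'
      rw [Finset.sdiff_eq_self_of_disjoint this]
      exact ⟨hne', hD⟩
    · rintro ⟨hVB, hV⟩
      have : Disjoint V B := π.disjoint hV hπ hVB
      refine ⟨V, hV, fun h => ?_, Finset.sdiff_eq_self_of_disjoint this⟩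
      obtain ⟨x, hx⟩ := π.nonempty_of_mem_parts hV
      exact (Finset.disjoint_left.1 this hx) (h hx)
  rw [Finset.mul_sum]
  refine Finset.sum_bij' (fun π _ => π.avoid B)
    (fun π _ => π.extend hne.ne_empty Finset.sdiff_disjoint
      (Finset.sdiff_union_of_subset hB)) ?_ ?_ ?_ ?_ ?_
  · intros; simp
  · intro π _; simp [Finpartition.extend]
  · intro π hπ
    have hπ' := (Finset.mem_filter.1 hπ).2
    ext1
    simp [Finpartition.extend, hav π hπ', Finset.insert_erase hπ']
  · intro π _
    ext1
    rw [hav _ (by simp [Finpartition.extend])]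
    simp [Finpartition.extend, Finset.erase_insert (hd π)]
  · intro π hπ
    have hπ' := (Finset.mem_filter.1 hπ).2
    rw [hav π hπ', ← Finset.mul_prod_erase _ _ hπ', Finset.card_erase_of_mem hπ',
      Nat.sub_add_cancel (Finset.card_pos.2 ⟨B, hπ'⟩)]
    ring

/-- Splitting a sum over partitions according to the block of a given element. -/
theorem sum_insert_block {s : Finset α} {x : α} (hx : x ∉ s) (a : ℕ → ℝ) (φ : ℕ → ℝ) :
    ∑ π : Finpartition (insert x s), (∏ V ∈ π.parts, a V.card) * φ π.parts.card =
      ∑ t ∈ s.powerset, a (t.card + 1) *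
        ∑ π : Finpartition (s \ t), (∏ V ∈ π.parts, a V.card) * φ (π.parts.card + 1) := by
  classical
  have key : ∀ π : Finpartition (insert x s),
      (π.part x).erase x ∈ s.powerset := by
    intro π
    rw [Finset.mem_powerset]
    intro y hy
    have h1 := π.part_subset x (Finset.mem_of_mem_erase hy)
    exact (Finset.mem_insert.1 h1).resolve_left (Finset.ne_of_mem_erase hy)
  rw [← Finset.sum_fiberwise_of_maps_to (s := Finset.univ) (t := s.powerset)
    (g := fun π : Finpartition (insert x s) => (π.part x).erase x) (fun π _ => key π)]
  refine Finset.sum_congr rfl fun t ht => ?_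
  have hts := Finset.mem_powerset.1 ht
  have hxt : x ∉ t := fun h => hx (hts h)
  have hfil : (Finset.univ.filter fun π : Finpartition (insert x s) => (π.part x).erase x = t) =
      Finset.univ.filter fun π : Finpartition (insert x s) => insert x t ∈ π.parts := by
    ext π
    simp only [Finset.mem_filter, Finset.mem_univ, true_and]
    have hxm : x ∈ π.part x := π.mem_part_self.2 (Finset.mem_insert_self _ _)
    constructor
    · rintro rfl
      rw [Finset.insert_erase hxm]
      exact π.part_mem.2 (Finset.mem_insert_self _ _)
    · intro h
      rw [π.part_eq_of_mem h (Finset.mem_insert_self _ _), Finset.erase_insert hxt]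
  have hsd : insert x s \ insert x t = s \ t := by
    rw [Finset.insert_sdiff_insert]
    exact Finset.sdiff_insert_of_notMem hx t
  rw [hfil, sum_filter_mem_parts (Finset.insert_subset_insert x hts) (Finset.insert_nonempty x t),
    hsd, Finset.card_insert_of_notMem hxt]

open PowerSeries

/-- The weighted sum over all partitions of a set with `n` elements, as a coefficient. -/
def egfSum (B : PowerSeries ℝ) (φ : ℕ → ℝ) (n : ℕ) : ℝ :=
  ∑ j ∈ range (n + 1), φ j * ((n.factorial : ℝ) / (j.factorial : ℝ)) * coeff n (B ^ j)

theorem coeff_pow_eq_zero {B : PowerSeries ℝ} (hB : constantCoeff B = 0) {j n : ℕ} (h : n < j) :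
    coeff n (B ^ j) = 0 := by
  have : (X : PowerSeries ℝ) ^ j ∣ B ^ j := pow_dvd_pow_of_dvd (X_dvd_iff.2 hB) j
  exact (X_pow_dvd_iff.1 this) n h

theorem egfSum_eq_sum_range {B : PowerSeries ℝ} (hB : constantCoeff B = 0) (φ : ℕ → ℝ)
    {n N : ℕ} (h : n < N) :
    egfSum B φ n =
      ∑ j ∈ range N, φ j * ((n.factorial : ℝ) / (j.factorial : ℝ)) * coeff n (B ^ j) := by
  refine Finset.sum_subset (fun j hj => ?_) fun j _ hj => ?_
  · rw [Finset.mem_range] at *; omega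
  · rw [coeff_pow_eq_zero hB (by rw [Finset.mem_range] at hj; omega), mul_zero]

/-- Comparing coefficients in (B^(j+1))' = (j+1) B^j B' produces the same recursion as removing from
a partition the block, of size k + 1, of a fixed element. -/
theorem egfSum_succ {B : PowerSeries ℝ} (hB : constantCoeff B = 0) (φ : ℕ → ℝ) (n : ℕ) :
    egfSum B φ (n + 1) = ∑ k ∈ range (n + 1), (n.choose k : ℝ) *
      (((k + 1).factorial : ℝ) * coeff (k + 1) B) * egfSum B (fun j => φ (j + 1)) (n - k) := by
  have h1 : ∀ k ∈ range (n + 1), (n.choose k : ℝ) *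
      (((k + 1).factorial : ℝ) * coeff (k + 1) B) * egfSum B (fun j => φ (j + 1)) (n - k) =
      ∑ j ∈ range (n + 1), φ (j + 1) * ((n.factorial : ℝ) / (j.factorial : ℝ)) *
        (coeff k (derivative ℝ B) * coeff (n - k) (B ^ j)) := by
    intro k hk
    have hkn : k ≤ n := Nat.lt_succ_iff.1 (Finset.mem_range.1 hk)
    rw [egfSum_eq_sum_range hB _ (N := n + 1) (by omega), Finset.mul_sum]
    refine Finset.sum_congr rfl fun j _ => ?_
    rw [coeff_derivative]
    have h2 : (n.choose k : ℝ) * (k.factorial : ℝ) * ((n - k).factorial : ℝ) = n.factorial := by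
      exact_mod_cast Nat.choose_mul_factorial_mul_factorial hkn
    rw [← h2, Nat.factorial_succ]
    push_cast
    ring
  rw [Finset.sum_congr rfl h1, Finset.sum_comm, egfSum, Finset.sum_range_succ']
  have h0 : coeff (n + 1) (B ^ 0) = 0 := by simp [coeff_one]
  rw [h0, mul_zero, add_zero]
  refine Finset.sum_congr rfl fun j _ => ?_
  rw [← Finset.mul_sum]
  have h3 : (coeff (n + 1) (B ^ (j + 1))) * ((n : ℝ) + 1) =
      (j + 1) * ∑ k ∈ range (n + 1), coeff k (derivative ℝ B) * coeff (n - k) (B ^ j) := by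
    rw [← coeff_derivative, Derivation.leibniz_pow, ← Nat.sum_antidiagonal_eq_sum_range_succ
      (fun k l => coeff k (derivative ℝ B) * coeff l (B ^ j)), ← coeff_mul]
    simp only [Nat.add_sub_cancel, smul_eq_mul, nsmul_eq_mul]
    rw [mul_comm (B ^ j), ← nsmul_eq_mul, map_nsmul, nsmul_eq_mul]
    push_cast; ring
  have h4 : ((j.factorial : ℕ) : ℝ) ≠ 0 := by positivity
  have h5 : (j : ℝ) + 1 ≠ 0 := by positivity
  rw [Nat.factorial_succ, Nat.factorial_succ]
  push_cast
  calc _ = φ (j + 1) * ((n.factorial : ℝ) / ((j + 1) * (j.factorial : ℝ))) *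
        (coeff (n + 1) (B ^ (j + 1)) * ((n : ℝ) + 1)) := by ring
    _ = _ := by rw [h3]; field_simp

/-- The exponential formula: both sides obey the recursion obtained by removing one block. The
weight `φ` varies in the induction, since each removal shifts its argument by one. -/
theorem sum_finpartition {B : PowerSeries ℝ} (hB : constantCoeff B = 0) {a : ℕ → ℝ}
    (hc : ∀ k, a (k + 1) = ((k + 1).factorial : ℝ) * coeff (k + 1) B) :
    ∀ (n : ℕ) (φ : ℕ → ℝ) (s : Finset α), s.card = n →
      ∑ π : Finpartition s, (∏ V ∈ π.parts, a V.card) * φ π.parts.card = egfSum B φ n := by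
  intro n
  induction n using Nat.strong_induction_on with
  | _ n ih =>
    intro φ s hs
    rcases n with _ | n
    · obtain rfl := Finset.card_eq_zero.1 hs
      have hp : ∀ π : Finpartition (∅ : Finset α), π.parts = ∅ :=
        fun π => π.parts_eq_empty_iff.2 rfl
      have hs1 : ∀ π π' : Finpartition (∅ : Finset α), π = π' :=
        fun π π' => Finpartition.ext ((hp π).trans (hp π').symm)
      refine (Fintype.sum_eq_single (show Finpartition (∅ : Finset α) from
        Finpartition.empty (Finset α)) fun π hπ => absurd (hs1 π _) hπ).trans ?_
      rw [hp]
      simp [egfSum]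
    · obtain ⟨x, t, hx, rfl, ht⟩ := Finset.card_eq_succ.1 hs
      rw [sum_insert_block hx, egfSum_succ hB]
      have h1 : ∀ u ∈ t.powerset, a (u.card + 1) *
          ∑ π : Finpartition (t \ u), (∏ V ∈ π.parts, a V.card) * φ (π.parts.card + 1) =
          (fun k => (((k + 1).factorial : ℝ) * coeff (k + 1) B) *
            egfSum B (fun j => φ (j + 1)) (n - k)) u.card := by
        intro u hu
        have hut := Finset.mem_powerset.1 hu
        rw [ih (n - u.card) (by omega) (fun j => φ (j + 1)) (t \ u)
          (by rw [Finset.card_sdiff_of_subset hut, ht]), hc]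
      rw [Finset.sum_congr rfl h1, Finset.sum_powerset_apply_card (fun k =>
        (((k + 1).factorial : ℝ) * coeff (k + 1) B) * egfSum B (fun j => φ (j + 1)) (n - k)), ht]
      exact Finset.sum_congr rfl fun k _ => by rw [nsmul_eq_mul]; ring

end SetPartition

namespace FiniteFree

open PowerSeries Finset

/-- The formal cumulants `∑_{π ∈ P(n)} a_π μ(π, 1_n)` of a sequence `a`. -/
def logCumulant (a : ℕ → ℝ) (n : ℕ) : ℝ :=
  ∑ π : Finpartition (Finset.univ : Finset (Fin n)), (∏ V ∈ π.parts, a V.card) * moebiusTop π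

theorem cumulant_eq_logCumulant (d n : ℕ) (p : Polynomial ℝ) :
    cumulant d n p =
      (-(d : ℝ)) ^ (n - 1) / ((n - 1).factorial : ℝ) * logCumulant (normCoeff d p) n := rfl

theorem card_mem_parts {n : ℕ} (π : Finpartition (Finset.univ : Finset (Fin n)))
    {V : Finset (Fin n)} (hV : V ∈ π.parts) : 1 ≤ V.card ∧ V.card ≤ n :=
  ⟨Finset.card_pos.2 (π.nonempty_of_mem_parts hV), by simpa using Finset.card_le_univ V⟩

theorem logCumulant_congr {a b : ℕ → ℝ} {n : ℕ} (h : ∀ k, 1 ≤ k → k ≤ n → a k = b k) :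
    logCumulant a n = logCumulant b n := by
  refine Finset.sum_congr rfl fun π _ => ?_
  congr 1
  exact Finset.prod_congr rfl fun V hV => h _ (card_mem_parts π hV).1 (card_mem_parts π hV).2

theorem logCumulant_scale (t : ℝ) (a : ℕ → ℝ) (n : ℕ) :
    logCumulant (fun i => t ^ i * a i) n = t ^ n * logCumulant a n := by
  simp only [logCumulant, Finset.mul_sum]
  refine Finset.sum_congr rfl fun π _ => ?_
  rw [Finset.prod_mul_distrib, Finset.prod_pow_eq_pow_sum, π.sum_card_parts]
  simp [mul_assoc]

theorem logCumulant_eq_egfSum {a : ℕ → ℝ} {A : PowerSeries ℝ} (hA : constantCoeff A = 1)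
    (ha : ∀ k, a (k + 1) = ((k + 1).factorial : ℝ) * coeff (k + 1) A) (n : ℕ) :
    logCumulant a n =
      SetPartition.egfSum (A - 1) (fun j => (-1) ^ (j - 1) * ((j - 1).factorial : ℝ)) n := by
  have := SetPartition.sum_finpartition (B := A - 1) (by simp [hA]) (a := a)
    (fun k => by rw [ha]; simp [coeff_one]) n
    (fun j => (-1) ^ (j - 1) * ((j - 1).factorial : ℝ)) (Finset.univ : Finset (Fin n)) (by simp)
  exact this

/-- The formal cumulants are the exponential coefficients of the logarithm of the exponential
generating function: `A' = A L'`. -/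
theorem derivative_eq_mul_logCumulant {a : ℕ → ℝ} {A : PowerSeries ℝ} (hA : constantCoeff A = 1)
    (ha : ∀ k, a (k + 1) = ((k + 1).factorial : ℝ) * coeff (k + 1) A) :
    derivative ℝ A = A * PowerSeries.mk fun n => logCumulant a (n + 1) / (n.factorial : ℝ) := by
  set B := A - 1 with hBdef
  have hB : constantCoeff B = 0 := by simp [hBdef, hA]
  have hAB : A = 1 + B := by simp [hBdef]
  have hdB : derivative ℝ B = derivative ℝ A := by simp [hBdef]
  -- The right side represents B'/(1 + B) by a truncated geometric series, which is exact in degrees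
  -- below N because B has no constant term.
  have hL : ∀ N n, n < N → logCumulant a (n + 1) / (n.factorial : ℝ) =
      coeff n ((∑ j ∈ range N, (-B) ^ j) * derivative ℝ B) := by
    intro N n hn
    -- Natural subtraction gives j = 0 the weight 1. This is harmless, as B^0 has no coefficient in
    -- positive degree.
    have hB0 : coeff (n + 1) (B ^ 0) = 0 := by simp [coeff_one]
    rw [logCumulant_eq_egfSum hA ha, SetPartition.egfSum_eq_sum_range hB _ (N := N + 1) (by omega),
      Finset.sum_range_succ', Finset.sum_mul, map_sum, hB0, mul_zero, add_zero, Finset.sum_div]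
    refine Finset.sum_congr rfl fun j _ => ?_
    have h3 : (coeff (n + 1) (B ^ (j + 1))) * ((n : ℝ) + 1) =
        (j + 1) * coeff n (B ^ j * derivative ℝ B) := by
      rw [← coeff_derivative, Derivation.leibniz_pow]
      simp only [Nat.add_sub_cancel, smul_eq_mul]
      rw [map_nsmul, nsmul_eq_mul]
      push_cast; ring
    have h6 : coeff n ((-B) ^ j * derivative ℝ B) = (-1) ^ j * coeff n (B ^ j * derivative ℝ B) := by
      rw [neg_pow, mul_assoc]
      have : ((-1 : PowerSeries ℝ) ^ j) = C ((-1 : ℝ) ^ j) := by simp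
      rw [this, coeff_C_mul]
    have h4 : ((j.factorial : ℕ) : ℝ) ≠ 0 := by positivity
    have h4' : ((n.factorial : ℕ) : ℝ) ≠ 0 := by positivity
    have h5 : (j : ℝ) + 1 ≠ 0 := by positivity
    rw [h6, Nat.factorial_succ, Nat.factorial_succ]
    push_cast
    have h7 : coeff n (B ^ j * derivative ℝ B) =
      (coeff (n + 1) (B ^ (j + 1))) * ((n : ℝ) + 1) / (j + 1) := by
      rw [h3]; field_simp
    rw [h7]
    field_simp
  ext n
  have hcoeff : coeff n (A * PowerSeries.mk fun n => logCumulant a (n + 1) / (n.factorial : ℝ)) =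
      coeff n (A * ((∑ j ∈ range (n + 1), (-B) ^ j) * derivative ℝ B)) := by
    rw [coeff_mul, coeff_mul]
    refine Finset.sum_congr rfl fun ij hij => ?_
    rw [coeff_mk, hL (n + 1) ij.2 (by have := Finset.HasAntidiagonal.mem_antidiagonal.1 hij; omega)]
  have hgeom : A * ((∑ j ∈ range (n + 1), (-B) ^ j) * derivative ℝ B) =
      derivative ℝ B - (-B) ^ (n + 1) * derivative ℝ B := by
    rw [← mul_assoc, hAB]
    have := mul_neg_geom_sum (-B) (n + 1)
    rw [sub_neg_eq_add] at this
    rw [this]; ring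
  have hz : coeff n ((-B) ^ (n + 1) * derivative ℝ B) = 0 := by
    have h1 : (X : PowerSeries ℝ) ^ (n + 1) ∣ (-B) ^ (n + 1) :=
      pow_dvd_pow_of_dvd (X_dvd_iff.2 (by simp [hB])) _
    exact X_pow_dvd_iff.1 (h1.mul_right _) n (Nat.lt_succ_self n)
  rw [hcoeff, hgeom, map_sub, hz, sub_zero, hdB]

/-- Coefficients of A' = A L'. The asymptotic analysis uses formal cumulants only through this
recursion, never through partitions. -/
theorem logCumulant_recursion {a : ℕ → ℝ} (h0 : a 0 = 1) (n : ℕ) :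
    a (n + 1) = ∑ k ∈ range (n + 1), (n.choose k : ℝ) * logCumulant a (k + 1) * a (n - k) := by
  have hf : ∀ k : ℕ, ((k.factorial : ℕ) : ℝ) ≠ 0 := fun k => by positivity
  have h := derivative_eq_mul_logCumulant (a := a)
    (A := PowerSeries.mk fun i => a i / (i.factorial : ℝ)) (by simp [h0])
    (fun k => by rw [coeff_mk, mul_div_cancel₀ _ (hf _)])
  have h2 := congrArg (coeff n) h
  rw [coeff_derivative, coeff_mk, mul_comm (PowerSeries.mk _), coeff_mul,
    Nat.sum_antidiagonal_eq_sum_range_succ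
      (fun k l => coeff k (PowerSeries.mk fun n => logCumulant a (n + 1) / (n.factorial : ℝ)) *
        coeff l (PowerSeries.mk fun i => a i / (i.factorial : ℝ)))] at h2
  have h3 : a (n + 1) = n.factorial * (a (n + 1) / ((n + 1).factorial : ℝ) * ((n : ℝ) + 1)) := by
    rw [Nat.factorial_succ]
    have := hf n
    have : (n : ℝ) + 1 ≠ 0 := by positivity
    push_cast
    field_simp
  rw [h3, h2, Finset.mul_sum]
  refine Finset.sum_congr rfl fun k hk => ?_
  have hkn : k ≤ n := Nat.lt_succ_iff.1 (Finset.mem_range.1 hk)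
  have h2 : (n.choose k : ℝ) * (k.factorial : ℝ) * ((n - k).factorial : ℝ) = n.factorial := by
    exact_mod_cast Nat.choose_mul_factorial_mul_factorial hkn
  rw [coeff_mk, coeff_mk, ← h2]
  have := hf k
  have := hf (n - k)
  field_simp

theorem logCumulant_one (a : ℕ → ℝ) : logCumulant a 1 = a 1 := by
  -- Blocks are nonempty, so the value at 0 never enters and may be replaced by 1.
  rw [logCumulant_congr (b := fun i => if i = 0 then 1 else a i)
    (fun k hk _ => by rw [if_neg (by omega)])]
  have := logCumulant_recursion (a := fun i => if i = 0 then 1 else a i) (by simp) 0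
  simpa using this.symm

/-- Formal cumulants of a power of an exponential generating function. -/
theorem logCumulant_egf_pow {A : PowerSeries ℝ} (hA : constantCoeff A = 1) (m n : ℕ) :
    logCumulant (fun i => (i.factorial : ℝ) * coeff i (A ^ m)) (n + 1) =
      m * logCumulant (fun i => (i.factorial : ℝ) * coeff i A) (n + 1) := by
  have h1 := derivative_eq_mul_logCumulant (a := fun i => (i.factorial : ℝ) * coeff i A) hA
    (fun k => rfl)
  have h2 := derivative_eq_mul_logCumulant (a := fun i => (i.factorial : ℝ) * coeff i (A ^ m))
    (A := A ^ m) (by simp [hA]) (fun k => rfl)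
  have hne : A ^ m ≠ 0 := pow_ne_zero _ (fun h => by simp [h] at hA)
  set K := PowerSeries.mk fun n =>
    logCumulant (fun i => (i.factorial : ℝ) * coeff i A) (n + 1) / (n.factorial : ℝ)
  have h3 : derivative ℝ (A ^ m) = A ^ m * (m • K) := by
    rw [Derivation.leibniz_pow, h1]
    rcases m with _ | m
    · simp
    · simp only [Nat.add_sub_cancel, smul_eq_mul]
      rw [pow_succ]
      simp only [nsmul_eq_mul]
      ring
  have h4 := mul_left_cancel₀ hne (h2.symm.trans h3)
  have h5 := congrArg (coeff n) h4
  rw [map_nsmul, coeff_mk, coeff_mk, nsmul_eq_mul] at h5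
  have hf : ((n.factorial : ℕ) : ℝ) ≠ 0 := by positivity
  field_simp at h5
  exact h5

end FiniteFree

end

/-! ### Finite differences and their symbols -/

section

open Finset PowerSeries Asymptotics

theorem fwdDiff_iter_zero_eq_sum (f : ℕ → ℝ) (n : ℕ) :
    (fwdDiff 1)^[n] f 0 =
      ∑ k ∈ range (n + 1), ((-1) ^ (n - k) * (n.choose k : ℝ)) * f k := by
  rw [fwdDiff_iter_eq_sum_shift]
  refine Finset.sum_congr rfl fun k _ => ?_
  simp

/-- The `n`-th difference at `0` of a product with a binomial coefficient. -/
theorem fwdDiff_iter_choose_mul (h : ℕ → ℝ) (n k : ℕ) (hk : k ≤ n) :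
    (fwdDiff 1)^[n] (fun i => (i.choose k : ℝ) * h (i - k)) 0 =
      (n.choose k : ℝ) * (fwdDiff 1)^[n - k] h 0 := by
  obtain ⟨l, rfl⟩ := Nat.exists_eq_add_of_le hk
  rw [fwdDiff_iter_zero_eq_sum, fwdDiff_iter_zero_eq_sum, Nat.add_sub_cancel_left,
    show k + l + 1 = k + (l + 1) by ring, Finset.sum_range_add, Finset.mul_sum,
    Finset.sum_eq_zero, zero_add]
  · refine Finset.sum_congr rfl fun j hj => ?_
    have h1 : ((k + l).choose (k + j) : ℝ) * ((k + j).choose k : ℝ) =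
        ((k + l).choose k : ℝ) * (l.choose j : ℝ) := by
      have := Nat.choose_mul (n := k + l) (k := k + j) (s := k)
        (Nat.le_add_right k j)
      rw [Nat.add_sub_cancel_left, Nat.add_sub_cancel_left] at this
      exact_mod_cast this
    rw [Nat.add_sub_cancel_left, Nat.add_sub_add_left]
    linear_combination ((-1) ^ (l - j) * h j) * h1
  · intro i hi
    rw [Nat.choose_eq_zero_of_lt (Finset.mem_range.1 hi)]
    simp

theorem fwdDiff_iter_one_succ (n : ℕ) : (fwdDiff 1)^[n + 1] (fun _ : ℕ => (1 : ℝ)) 0 = 0 := by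
  have := fwdDiff_iter_pow_eq_zero_of_lt (R := ℝ) (j := 0) (n := n + 1) (by omega)
  rw [fwdDiff_iter_zero_eq_sum]
  have h2 := congrFun this 0
  rw [fwdDiff_iter_eq_sum_shift] at h2
  simpa using h2

/-- Up to sign this is the n-th difference of a polynomial of degree n - 1. It identifies the limit
in both halves of the theorem: x = 1 for the finite free cumulants, x = 0 for the free ones. -/
theorem sum_alternating_choose_mul_add_pow (x : ℝ) {n : ℕ} (hn : 1 ≤ n) :
    ∑ k ∈ range (n + 1), ((-1) ^ k * (n.choose k : ℝ)) * ((k : ℝ) + x) ^ (n - 1) = 0 := by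
  have := fwdDiff_iter_pow_eq_zero_of_lt (R := ℝ) (j := n - 1) (n := n) (by omega)
  have h2 := congrFun this x
  rw [fwdDiff_iter_eq_sum_shift] at h2
  have h3 : ∑ k ∈ range (n + 1), ((-1) ^ k * (n.choose k : ℝ)) * ((k : ℝ) + x) ^ (n - 1) =
      (-1) ^ n * ∑ k ∈ range (n + 1),
        ((-1 : ℤ) ^ (n - k) * (n.choose k : ℤ)) • (x + k • 1) ^ (n - 1) := by
    rw [Finset.mul_sum]
    refine Finset.sum_congr rfl fun k hk => ?_
    have hkn : k ≤ n := Nat.lt_succ_iff.1 (Finset.mem_range.1 hk)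
    have h4 : (-1 : ℝ) ^ n * (-1) ^ (n - k) = (-1) ^ k := by
      obtain ⟨l, rfl⟩ := Nat.exists_eq_add_of_le hkn
      rw [Nat.add_sub_cancel_left, pow_add, mul_assoc, ← pow_add, Even.neg_one_pow ⟨l, rfl⟩,
        mul_one]
    rw [← h4, zsmul_eq_mul]
    push_cast
    rw [nsmul_eq_mul, mul_one, add_comm x]
    ring
  rw [h3, h2]
  simp

variable {ι : Type*}

/-- As the step `ε` tends to `0`, the scaled differences `Δ^k g(0) / ε^k`, `k ≤ N`, tend to the
derivatives at `0` of the formal power series `G`; informally `g(i) ≈ G(ε i)`. -/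
def HasSymbol (ε : ι → ℝ) (l : Filter ι) (N : ℕ) (g : ι → ℕ → ℝ) (G : PowerSeries ℝ) : Prop :=
  ∀ k ≤ N, Tendsto (fun q => (fwdDiff 1)^[k] (g q) 0 / ε q ^ k) l
    (𝓝 ((k.factorial : ℝ) * coeff k G))

namespace HasSymbol

variable {ε : ι → ℝ} {l : Filter ι} {N M : ℕ} {f g : ι → ℕ → ℝ} {F G : PowerSeries ℝ}

theorem mono (h : HasSymbol ε l N g G) (hM : M ≤ N) : HasSymbol ε l M g G :=
  fun k hk => h k (hk.trans hM)

theorem congr (h : HasSymbol ε l N g G) (hfg : ∀ i ≤ N, ∀ᶠ q in l, g q i = f q i) :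
    HasSymbol ε l N f G := by
  intro k hk
  refine (h k hk).congr' ?_
  have : ∀ᶠ q in l, ∀ i ∈ range (k + 1), g q i = f q i :=
    (Filter.eventually_all_finset _).2
      fun i hi => hfg i ((Nat.lt_succ_iff.1 (Finset.mem_range.1 hi)).trans hk)
  filter_upwards [this] with q hq
  rw [fwdDiff_iter_zero_eq_sum, fwdDiff_iter_zero_eq_sum]
  congr 1
  exact Finset.sum_congr rfl fun i hi => by rw [hq i hi]

theorem congr_symbol (h : HasSymbol ε l N g G) (hFG : ∀ k ≤ N, coeff k G = coeff k F) :
    HasSymbol ε l N g F := fun k hk => by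
  rw [← hFG k hk]; exact h k hk

theorem add (hf : HasSymbol ε l N f F) (hg : HasSymbol ε l N g G) :
    HasSymbol ε l N (fun q i => f q i + g q i) (F + G) := by
  intro k hk
  have := (hf k hk).add (hg k hk)
  rw [map_add, mul_add]
  refine this.congr fun q => ?_
  rw [← add_div]
  congr 1
  exact (congrFun (fwdDiff_iter_add (h := 1) (f q) (g q) k) 0).symm

theorem iter_const_mul (c : ℝ) (f : ℕ → ℝ) (k : ℕ) :
    (fwdDiff 1)^[k] (fun i => c * f i) 0 = c * (fwdDiff 1)^[k] f 0 := by
  rw [fwdDiff_iter_zero_eq_sum, fwdDiff_iter_zero_eq_sum, Finset.mul_sum]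
  exact Finset.sum_congr rfl fun i _ => by ring

theorem scalar_mul {c : ι → ℝ} {c₀ : ℝ} (hc : Tendsto c l (𝓝 c₀)) (hg : HasSymbol ε l N g G) :
    HasSymbol ε l N (fun q i => c q * g q i) (c₀ • G) := by
  intro k hk
  have := hc.mul (hg k hk)
  rw [map_smul, smul_eq_mul, mul_left_comm]
  refine this.congr fun q => ?_
  rw [iter_const_mul, mul_div_assoc]

theorem const_mul (c : ℝ) (hg : HasSymbol ε l N g G) :
    HasSymbol ε l N (fun q i => c * g q i) (c • G) := scalar_mul tendsto_const_nhds hg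

theorem const (c : ℝ) : HasSymbol ε l N (fun _ _ => c) (C c) := by
  intro k _
  rcases k with _ | k
  · simpa using tendsto_const_nhds
  · have h : ∀ q, (fwdDiff 1)^[k + 1] ((fun (_ : ι) (_ : ℕ) => c) q) 0 / ε q ^ (k + 1) = 0 := by
      intro q
      have := iter_const_mul c (fun _ => 1) (k + 1)
      simp only [mul_one] at this
      rw [this, fwdDiff_iter_one_succ]; simp
    simp only [h, coeff_C, Nat.succ_ne_zero, if_false, mul_zero]
    exact tendsto_const_nhds

theorem sum {κ : Type*} (s : Finset κ) {f : κ → ι → ℕ → ℝ} {F : κ → PowerSeries ℝ}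
    (h : ∀ j ∈ s, HasSymbol ε l N (f j) (F j)) :
    HasSymbol ε l N (fun q i => ∑ j ∈ s, f j q i) (∑ j ∈ s, F j) := by
  classical
  induction s using Finset.induction_on with
  | empty => simpa using const (ε := ε) (l := l) (N := N) 0
  | insert a s ha ih =>
    simp only [Finset.sum_insert ha]
    exact (h a (Finset.mem_insert_self _ _)).add (ih fun j hj => h j (Finset.mem_insert_of_mem hj))

theorem tendsto_zero (h : HasSymbol ε l N g G) :
    Tendsto (fun q => g q 0) l (𝓝 (coeff 0 G)) := by
  simpa using h 0 (Nat.zero_le _)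

/-- Since Δ^{k+1} g = Δ^k(Δg), passing to Δg/ε differentiates the symbol at the cost of one order.
Inductions on N rest on this. -/
theorem succ_iff : HasSymbol ε l (N + 1) g G ↔
    Tendsto (fun q => g q 0) l (𝓝 (coeff 0 G)) ∧
      HasSymbol ε l N (fun q i => (g q (i + 1) - g q i) / ε q) (derivative ℝ G) := by
  have key : ∀ k q, (fwdDiff 1)^[k + 1] (g q) 0 / ε q ^ (k + 1) =
      (fwdDiff 1)^[k] (fun i => (g q (i + 1) - g q i) / ε q) 0 / ε q ^ k := by
    intro k q
    have h1 : (fwdDiff 1)^[k + 1] (g q) 0 = (fwdDiff 1)^[k] (fun i => g q (i + 1) - g q i) 0 := by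
      rw [Function.iterate_succ_apply]; rfl
    have h2 : (fun i => (g q (i + 1) - g q i) / ε q) =
        fun i => (ε q)⁻¹ * (g q (i + 1) - g q i) := by
      ext i; rw [div_eq_inv_mul]
    rw [h1, h2, iter_const_mul, pow_succ]
    rw [div_mul_eq_div_div, div_right_comm, div_eq_inv_mul _ (ε q)]
  have key2 : ∀ k : ℕ, ((k + 1).factorial : ℝ) * coeff (k + 1) G =
      (k.factorial : ℝ) * coeff k (derivative ℝ G) := by
    intro k
    rw [coeff_derivative, Nat.factorial_succ]; push_cast; ring
  constructor
  · intro h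
    refine ⟨h.tendsto_zero, fun k hk => ?_⟩
    have := h (k + 1) (by omega)
    simp only [key, key2] at this
    exact this
  · rintro ⟨h0, h1⟩ k hk
    rcases k with _ | k
    · simpa using h0
    · simp only [key, key2]
      exact h1 k (by omega)

/-- g(i+1) = g(i) + ε · (Δg/ε), and the factor ε removes the second symbol in the limit. One order
is lost because Δg/ε is controlled to one order less. -/
theorem shift (hε : Tendsto ε l (𝓝 0)) (hne : ∀ᶠ q in l, ε q ≠ 0)
    (h : HasSymbol ε l (N + 1) g G) : HasSymbol ε l N (fun q i => g q (i + 1)) G := by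
  have h1 := (h.mono N.le_succ).add (scalar_mul hε (succ_iff.1 h).2)
  rw [zero_smul, add_zero] at h1
  refine h1.congr fun i _ => ?_
  filter_upwards [hne] with q hq
  field_simp
  ring

theorem shift_add (hε : Tendsto ε l (𝓝 0)) (hne : ∀ᶠ q in l, ε q ≠ 0) (t : ℕ)
    (h : HasSymbol ε l (N + t) g G) : HasSymbol ε l N (fun q i => g q (i + t)) G := by
  induction t generalizing N with
  | zero => exact h
  | succ t ih =>
    have := shift hε hne (ih (N := N + 1) (by rw [show N + 1 + t = N + (t + 1) by ring]; exact h))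
    refine this.congr fun i _ => Eventually.of_forall fun q => ?_
    show g q (i + 1 + t) = g q (i + (t + 1))
    congr 1; ring

/-- Discrete Leibniz rule Δ(fg) = Δf · g + f(· + 1) · Δg. The shift in f is invisible in the limit,
so the symbols follow the ordinary Leibniz rule. -/
theorem mul (hε : Tendsto ε l (𝓝 0)) (hne : ∀ᶠ q in l, ε q ≠ 0)
    (hf : HasSymbol ε l N f F) (hg : HasSymbol ε l N g G) :
    HasSymbol ε l N (fun q i => f q i * g q i) (F * G) := by
  induction N generalizing f g F G with
  | zero =>
    intro k hk
    obtain rfl : k = 0 := by omega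
    have := hf.tendsto_zero.mul hg.tendsto_zero
    simpa using this
  | succ N ih =>
    rw [succ_iff]
    refine ⟨by simpa using hf.tendsto_zero.mul hg.tendsto_zero, ?_⟩
    have h1 := ih (succ_iff.1 hf).2 (hg.mono N.le_succ)
    have h2 := ih (hf.shift hε hne) (succ_iff.1 hg).2
    refine ((h1.add h2).congr fun i _ => Eventually.of_forall fun q => ?_).congr_symbol
      fun k _ => ?_
    · ring
    · rw [Derivation.leibniz, smul_eq_mul, smul_eq_mul, add_comm, mul_comm G]

theorem pow (hε : Tendsto ε l (𝓝 0)) (hne : ∀ᶠ q in l, ε q ≠ 0)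
    (hg : HasSymbol ε l N g G) (r : ℕ) :
    HasSymbol ε l N (fun q i => g q i ^ r) (G ^ r) := by
  induction r with
  | zero => simpa using const (ε := ε) (l := l) (N := N) 1
  | succ r ih => simpa only [pow_succ] using ih.mul hε hne hg

/-- A k-th difference is a fixed finite combination of values, and ε^N = O(ε^k) for k ≤ N. -/
theorem of_isLittleO (hε : Tendsto ε l (𝓝 0)) (h : ∀ i ≤ N, (fun q => g q i) =o[l] (fun q => ε q ^ N)) :
    HasSymbol ε l N g 0 := by
  intro k hk
  have h1 : (fun q => ε q ^ N) =O[l] (fun q => ε q ^ k) :=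
    have h0 : (fun x : ℝ => x ^ N) =O[𝓝 0] fun x => x ^ k := by
      rcases hk.eq_or_lt with rfl | hk
      · exact isBigO_refl _ _
      · exact (isLittleO_pow_pow hk).isBigO
    h0.comp_tendsto hε
  have h2 : (fun q => (fwdDiff 1)^[k] (g q) 0) =o[l] (fun q => ε q ^ k) := by
    simp only [fwdDiff_iter_zero_eq_sum]
    refine IsLittleO.fun_sum fun i hi => ?_
    exact ((h i ((Nat.lt_succ_iff.1 (Finset.mem_range.1 hi)).trans hk)).trans_isBigO h1).const_mul_left _
  simpa using h2.tendsto_div_nhds_zero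

/-- Composition with a function that has a Taylor expansion at `0`. -/
theorem comp_taylor (hε : Tendsto ε l (𝓝 0)) (hne : ∀ᶠ q in l, ε q ≠ 0)
    (hg : HasSymbol ε l N g G) (hO : ∀ i, (fun q => g q i) =O[l] ε)
    {φ : ℝ → ℝ} {c : ℕ → ℝ}
    (hφ : (fun x => φ x - ∑ r ∈ range (N + 1), c r * x ^ r) =O[𝓝 0] fun x => x ^ (N + 1)) :
    HasSymbol ε l N (fun q i => φ (g q i)) (∑ r ∈ range (N + 1), c r • G ^ r) := by
  -- The Taylor polynomial is handled by products. Because the values of g are O(ε), the remainder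
  -- is O(ε^(N+1)) and does not affect differences up to order N.
  have h1 := sum (range (N + 1)) fun r _ => const_mul (c r) (hg.pow hε hne r)
  have h2 : HasSymbol ε l N (fun q i => φ (g q i) - ∑ r ∈ range (N + 1), c r * g q i ^ r) 0 := by
    refine of_isLittleO hε fun i _ => ?_
    have h3 := hφ.comp_tendsto ((hO i).trans_tendsto hε)
    have h4 : (fun q => g q i ^ (N + 1)) =O[l] fun q => ε q ^ (N + 1) := (hO i).pow _
    have h5 : (fun q => ε q ^ (N + 1)) =o[l] fun q => ε q ^ N := by
      have : (fun x : ℝ => x ^ (N + 1)) =o[𝓝 0] fun x => x ^ N := isLittleO_pow_pow N.lt_succ_self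
      exact this.comp_tendsto hε
    exact (h3.trans h4).trans_isLittleO h5
  have h6 := h2.add h1
  rw [zero_add] at h6
  exact h6.congr fun i _ => Eventually.of_forall fun q => by ring

end HasSymbol

theorem AnalyticAt.exists_taylor_isBigO {φ : ℝ → ℝ} (h : AnalyticAt ℝ φ 0) :
    ∃ c : ℕ → ℝ, ∀ N : ℕ,
      (fun x => φ x - ∑ r ∈ range (N + 1), c r * x ^ r) =O[𝓝 0] fun x => x ^ (N + 1) := by
  obtain ⟨p, hp⟩ := h
  refine ⟨p.coeff, fun N => ?_⟩
  have := hp.isBigO_sub_partialSum_pow (N + 1)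
  refine (this.congr (fun x => ?_) fun x => rfl).trans (IsBigO.of_norm_left (by
    simpa using (isBigO_refl (fun x : ℝ => x ^ (N + 1)) (𝓝 0)).norm_left))
  rw [zero_add, FormalMultilinearSeries.partialSum]
  congr 1
  refine Finset.sum_congr rfl fun r _ => ?_
  rw [FormalMultilinearSeries.apply_eq_pow_smul_coeff, smul_eq_mul, mul_comm]

theorem Real.exp_taylor_isBigO (N : ℕ) :
    (fun x : ℝ => Real.exp x - ∑ r ∈ range (N + 1), (r.factorial : ℝ)⁻¹ * x ^ r) =O[𝓝 0]
      fun x => x ^ (N + 1) := by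
  refine (Real.exp_sub_sum_range_isBigO_pow (N + 1)).congr_left fun x => ?_
  congr 1
  exact Finset.sum_congr rfl fun r _ => by rw [div_eq_inv_mul]

end

/-! ### Sequences with small cumulants, and the scaling limit of powers -/

section

open Finset PowerSeries Asymptotics

theorem fwdDiff_iter_zero_congr {f g : ℕ → ℝ} {n : ℕ} (h : ∀ i ≤ n, f i = g i) :
    (fwdDiff 1)^[n] f 0 = (fwdDiff 1)^[n] g 0 := by
  rw [fwdDiff_iter_zero_eq_sum, fwdDiff_iter_zero_eq_sum]
  exact Finset.sum_congr rfl fun i hi => by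
    rw [h i (Nat.lt_succ_iff.1 (Finset.mem_range.1 hi))]

/-- The binomial weight absorbs k of the n differences. A recursion weighted by cumulants thereby
becomes an identity in which the k-th cumulant meets a difference of order only n - k. -/
theorem fwdDiff_iter_sum_choose_mul (c : ℕ → ℝ) (P : ℕ → ℕ → ℝ) (n : ℕ) :
    (fwdDiff 1)^[n] (fun i => ∑ k ∈ range (n + 1), (i.choose k : ℝ) * (c k * P k (i - k))) 0 =
      ∑ k ∈ range (n + 1), (n.choose k : ℝ) * (c k * (fwdDiff 1)^[n - k] (P k) 0) := by
  rw [fwdDiff_iter_zero_eq_sum]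
  simp only [Finset.mul_sum]
  rw [Finset.sum_comm]
  refine Finset.sum_congr rfl fun k hk => ?_
  have := fwdDiff_iter_choose_mul (P k) n k (Nat.lt_succ_iff.1 (Finset.mem_range.1 hk))
  rw [fwdDiff_iter_zero_eq_sum] at this
  rw [mul_left_comm, ← this, Finset.mul_sum]
  exact Finset.sum_congr rfl fun i _ => by ring

theorem choose_mul_eq_zero_of_lt {i k : ℕ} (h : i < k) (x : ℝ) : (i.choose k : ℝ) * x = 0 := by
  rw [Nat.choose_eq_zero_of_lt h]; simp

variable {ι : Type*} {l : Filter ι}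

/-- A symbol is constrained only in degrees up to N, so its coefficient of degree N + 1 may be
prescribed. -/
theorem HasSymbol.extend {ε : ι → ℝ} {N : ℕ} {g : ι → ℕ → ℝ} {G : PowerSeries ℝ}
    (h : HasSymbol ε l N g G) {L : ℝ}
    (hL : Tendsto (fun q => (fwdDiff 1)^[N + 1] (g q) 0 / ε q ^ (N + 1)) l (𝓝 L)) :
    ∃ G', HasSymbol ε l (N + 1) g G' := by
  refine ⟨PowerSeries.mk fun k => if k = N + 1 then L / ((N + 1).factorial : ℝ) else coeff k G,
    fun k hk => ?_⟩
  rw [coeff_mk]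
  split_ifs with h1
  · subst h1
    rwa [mul_div_cancel₀ _ (by positivity)]
  · exact h k (by omega)

/-- Exponential generating functions whose `n`-th cumulants `c n` (with a shift of the index) are
of order `δ ^ n`. -/
structure SmallCumulants (δ : ι → ℝ) (l : Filter ι) (a c : ι → ℕ → ℝ) : Prop where
  tendsto : Tendsto δ l (𝓝 0)
  ne_zero : ∀ᶠ q in l, δ q ≠ 0
  init : ∀ᶠ q in l, a q 0 = 1
  mean : ∀ᶠ q in l, c q 0 = 1
  limit : ∀ k, ∃ γ, Tendsto (fun q => c q k / δ q ^ k) l (𝓝 γ)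
  recursion : ∀ n, ∀ᶠ q in l,
    a q (n + 1) = ∑ k ∈ range (n + 1), (n.choose k : ℝ) * (c q k * a q (n - k))

namespace SmallCumulants

variable {δ : ι → ℝ} {a c : ι → ℕ → ℝ}

theorem isBigO (h : SmallCumulants δ l a c) (k : ℕ) :
    (fun q => c q (k + 1)) =O[l] δ := by
  obtain ⟨γ, hγ⟩ := h.limit (k + 1)
  have h1 : (fun q => c q (k + 1) / δ q ^ (k + 1) * δ q ^ k) =O[l] fun _ => (1 : ℝ) :=
    (hγ.mul (h.tendsto.pow k)).isBigO_one ℝ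
  have h2 := h1.mul (isBigO_refl δ l)
  simp only [one_mul] at h2
  refine h2.congr' ?_ EventuallyEq.rfl
  filter_upwards [h.ne_zero] with q hq
  field_simp
  ring

theorem tendsto_one (h : SmallCumulants δ l a c) (n : ℕ) :
    Tendsto (fun q => a q n) l (𝓝 1) := by
  induction n using Nat.strong_induction_on with
  | _ n ih =>
    rcases n with _ | n
    · exact tendsto_const_nhds.congr' (h.init.mono fun q hq => hq.symm)
    · have h1 : Tendsto (fun q => ∑ k ∈ range (n + 1), (n.choose k : ℝ) * (c q k * a q (n - k))) l
          (𝓝 (∑ k ∈ range (n + 1), (n.choose k : ℝ) * ((if k = 0 then 1 else 0) * 1))) := by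
        refine tendsto_finsetSum _ fun k hk => Tendsto.const_mul _ (Tendsto.mul ?_ (ih _ (by omega)))
        rcases k with _ | k
        · exact tendsto_const_nhds.congr' (h.mean.mono fun q hq => by simp [hq])
        · simpa using (h.isBigO k).trans_tendsto h.tendsto
      have h2 : (∑ k ∈ range (n + 1), (n.choose k : ℝ) * ((if k = 0 then 1 else 0) * 1)) = 1 := by
        simp
      rw [h2] at h1
      exact h1.congr' ((h.recursion n).mono fun q hq => hq.symm)

theorem eventually_ne_zero (h : SmallCumulants δ l a c) (n : ℕ) : ∀ᶠ q in l, a q n ≠ 0 :=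
  (h.tendsto_one n).eventually_ne one_ne_zero

theorem ratio_sub_one_isBigO (h : SmallCumulants δ l a c) (n : ℕ) :
    (fun q => a q (n + 1) / a q n - 1) =O[l] δ := by
  have h1 : (fun q => ∑ k ∈ range n,
      (n.choose (k + 1) : ℝ) * (c q (k + 1) * (a q (n - (k + 1)) / a q n))) =O[l] δ := by
    refine IsBigO.fun_sum fun k _ => IsBigO.const_mul_left ?_ _
    have h2 : (fun q => a q (n - (k + 1)) / a q n) =O[l] fun _ => (1 : ℝ) :=
      ((h.tendsto_one _).div (h.tendsto_one n) one_ne_zero).isBigO_one ℝ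
    simpa using (h.isBigO k).mul h2
  refine h1.congr' ?_ EventuallyEq.rfl
  filter_upwards [h.recursion n, h.mean, h.eventually_ne_zero n] with q h2 h3 h4
  rw [h2, Finset.sum_range_succ', add_div, Finset.sum_div]
  have h5 : (n.choose 0 : ℝ) * (c q 0 * a q (n - 0)) / a q n = 1 := by
    simp [h3, h4]
  rw [h5, add_sub_cancel_right]
  exact Finset.sum_congr rfl fun k _ => by ring

/-- Divided by a_i, the recursion has (N+1)-st difference ∑ C(N+1,k) c_k Δ^{N+1-k}(a_j/a_{j+k})(0).
As c_k is of order δ^k, scaled differences of order N + 1 - k suffice. For k = 0 the function is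
constant; for k ≥ 1 the order is at most N, within reach of the induction hypothesis. -/
theorem exists_hasSymbol_ratio (h : SmallCumulants δ l a c) (N : ℕ) :
    ∃ R, HasSymbol δ l N (fun q i => a q (i + 1) / a q i) R := by
  induction N with
  | zero =>
    refine ⟨C 1, fun k hk => ?_⟩
    obtain rfl : k = 0 := by omega
    simpa [Pi.div_def] using (h.tendsto_one 1).div (h.tendsto_one 0) one_ne_zero
  | succ N ih =>
    obtain ⟨R, hR⟩ := ih
    obtain ⟨t, ht⟩ := (show AnalyticAt ℝ (fun x : ℝ => (1 + x)⁻¹) 0 from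
      (analyticAt_const.add analyticAt_id).inv (by simp)).exists_taylor_isBigO
    have hinv : ∃ S, HasSymbol δ l N (fun q i => a q i / a q (i + 1)) S := by
      refine ⟨_, (HasSymbol.comp_taylor h.tendsto h.ne_zero
        (hR.add (HasSymbol.const (-1))) (fun i => ?_) (ht N)).congr
          fun i _ => Eventually.of_forall fun q => ?_⟩
      · simpa [sub_eq_add_neg] using h.ratio_sub_one_isBigO i
      · show (1 + (a q (i + 1) / a q i + -1))⁻¹ = _
        rw [add_neg_cancel_comm_assoc, inv_div]
    obtain ⟨S, hS⟩ := hinv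
    -- These quotients are products of shifted inverse ratios. Every further factor costs one order
    -- through its shift, leaving exactly the N - k needed.
    have hP : ∀ k ≤ N, ∃ G, HasSymbol δ l (N - k) (fun q j => a q j / a q (j + (k + 1))) G := by
      intro k
      induction k with
      | zero => exact fun _ => ⟨S, hS⟩
      | succ k ihk =>
        intro hk
        obtain ⟨G, hG⟩ := ihk (by omega)
        rw [show N - k = N - (k + 1) + 1 by omega] at hG
        refine ⟨_, ((hS.mono (Nat.sub_le N (k + 1))).mul h.tendsto h.ne_zero
          (hG.shift h.tendsto h.ne_zero)).congr fun i _ => ?_⟩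
        filter_upwards [h.eventually_ne_zero (i + 1)] with q hq
        rw [div_mul_div_cancel₀ hq]
        congr 2; ring
    have hP' : ∀ k ≤ N + 1, ∃ L, Tendsto (fun q =>
        (fwdDiff 1)^[N + 1 - k] (fun j => a q j / a q (j + k)) 0 / δ q ^ (N + 1 - k)) l (𝓝 L) := by
      intro k hk
      rcases k with _ | k
      · refine ⟨0, tendsto_const_nhds.congr' ?_⟩
        have h1 : ∀ᶠ q in l, ∀ i ∈ range (N + 2), a q i ≠ 0 :=
          (Filter.eventually_all_finset _).2 fun i _ => h.eventually_ne_zero i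
        filter_upwards [h1] with q hq
        rw [Nat.sub_zero, fwdDiff_iter_zero_congr (g := fun _ => 1) (fun i hi => by
          rw [add_zero, div_self (hq i (Finset.mem_range.2 (by omega)))]), fwdDiff_iter_one_succ]
        simp
      · obtain ⟨G, hG⟩ := hP k (by omega)
        rw [Nat.add_sub_add_right]
        exact ⟨_, hG (N - k) le_rfl⟩
    choose! L hL using hP'
    choose γ hγ using h.limit
    have hlim : Tendsto (fun q => ∑ k ∈ range (N + 1 + 1), ((N + 1).choose k : ℝ) *
        (c q k / δ q ^ k * ((fwdDiff 1)^[N + 1 - k] (fun j => a q j / a q (j + k)) 0 /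
          δ q ^ (N + 1 - k)))) l (𝓝 (∑ k ∈ range (N + 1 + 1), ((N + 1).choose k : ℝ) *
            (γ k * L k))) :=
      tendsto_finsetSum _ fun k hk => Tendsto.const_mul _
        ((hγ k).mul (hL k (Nat.lt_succ_iff.1 (Finset.mem_range.1 hk))))
    refine hR.extend (hlim.congr' ?_)
    have h2 : ∀ᶠ q in l, ∀ i ∈ range (N + 2),
        a q (i + 1) = ∑ k ∈ range (i + 1), (i.choose k : ℝ) * (c q k * a q (i - k)) :=
      (Filter.eventually_all_finset _).2 fun i _ => h.recursion i
    filter_upwards [h2, h.ne_zero] with q hq2 hδ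
    have h3 : ∀ i ≤ N + 1, a q (i + 1) / a q i =
        ∑ k ∈ range (N + 1 + 1), (i.choose k : ℝ) *
          (c q k * (fun j => a q j / a q (j + k)) (i - k)) := by
      intro i hi
      rw [hq2 i (Finset.mem_range.2 (by omega)), Finset.sum_div]
      refine (Finset.sum_subset (Finset.range_subset_range.2 (by omega : i + 1 ≤ N + 1 + 1))
        fun k _ hk => ?_).trans (Finset.sum_congr rfl fun k hk => ?_)
      · rw [choose_mul_eq_zero_of_lt (by rw [Finset.mem_range] at hk; omega), zero_div]
      · rcases lt_or_ge i k with hik | hik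
        · rw [choose_mul_eq_zero_of_lt hik, choose_mul_eq_zero_of_lt hik, zero_div]
        · simp only [Nat.sub_add_cancel hik]; ring
    rw [fwdDiff_iter_zero_congr h3,
      fwdDiff_iter_sum_choose_mul (c q) (fun k j => a q j / a q (j + k)), Finset.sum_div]
    refine Finset.sum_congr rfl fun k hk => ?_
    have : δ q ^ (N + 1) = δ q ^ k * δ q ^ (N + 1 - k) := by
      rw [← pow_add]; congr 1; have := Finset.mem_range.1 hk; omega
    rw [this, mul_div_assoc, mul_div_mul_comm]

theorem exists_hasSymbol_log_ratio (h : SmallCumulants δ l a c) (N : ℕ) :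
    ∃ R, HasSymbol δ l N (fun q i => Real.log (a q (i + 1) / a q i)) R := by
  obtain ⟨R, hR⟩ := h.exists_hasSymbol_ratio N
  obtain ⟨t, ht⟩ := (show AnalyticAt ℝ (fun x : ℝ => Real.log (1 + x)) 0 from
      (analyticAt_const.add analyticAt_id).log (by simp)).exists_taylor_isBigO
  refine ⟨_, (HasSymbol.comp_taylor h.tendsto h.ne_zero
    (hR.add (HasSymbol.const (-1))) (fun i => ?_) (ht N)).congr
      fun i _ => Eventually.of_forall fun q => ?_⟩
  · simpa [sub_eq_add_neg] using h.ratio_sub_one_isBigO i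
  · show Real.log (1 + (a q (i + 1) / a q i + -1)) = _
    rw [add_neg_cancel_comm_assoc]

theorem log_one_add_isBigO : (fun x : ℝ => Real.log (1 + x)) =O[𝓝 0] fun x => x := by
  have h : DifferentiableAt ℝ (fun x : ℝ => Real.log (1 + x)) 0 :=
    (differentiableAt_id.const_add 1).log (by simp)
  simpa using h.isBigO_sub

theorem log_ratio_isBigO (h : SmallCumulants δ l a c) (n : ℕ) :
    (fun q => Real.log (a q (n + 1) / a q n)) =O[l] δ := by
  have h1 := h.ratio_sub_one_isBigO n
  refine ((log_one_add_isBigO.comp_tendsto (h1.trans_tendsto h.tendsto)).trans h1).congr_left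
    fun q => ?_
  simp [Function.comp]

end SmallCumulants

/-- Taking powers of order `m` zooms into the linear part of the symbol. -/
theorem HasSymbol.zoom {δ m : ι → ℝ} {ρ : ι → ℕ → ℝ} {κ : ℝ} {N : ℕ}
    (hm : Tendsto m l atTop) (hρ : ∃ G, HasSymbol δ l N ρ G)
    (h0 : ∀ᶠ q in l, ρ q 0 = 0) (h1 : Tendsto (fun q => ρ q 1 / δ q) l (𝓝 (-κ))) :
    HasSymbol (fun q => m q * δ q) l N (fun q i => m q * ρ q i) ((-κ) • X) := by
  obtain ⟨G, hG⟩ := hρ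
  have hm0 : ∀ᶠ q in l, m q ≠ 0 := (hm.eventually_gt_atTop 0).mono fun q hq => hq.ne'
  intro k hk
  rcases k with _ | _ | k
  · simp only [Function.iterate_zero, id, pow_zero, div_one, map_smul, coeff_zero_X, smul_zero,
      mul_zero]
    exact tendsto_const_nhds.congr' (h0.mono fun q hq => by simp [hq])
  · have : ((0 + 1 : ℕ).factorial : ℝ) * coeff (0 + 1) ((-κ) • (X : PowerSeries ℝ)) = -κ := by
      simp [coeff_one_X]
    rw [this]
    refine h1.congr' ?_
    filter_upwards [h0, hm0] with q hq hmq
    have h2 : (fwdDiff 1)^[0 + 1] (fun i => m q * ρ q i) 0 = m q * ρ q 1 - m q * ρ q 0 := rfl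
    rw [h2, hq, mul_zero, sub_zero, zero_add, pow_one, mul_div_mul_left _ _ hmq]
  -- One factor m against its power k + 2 in the scale leaves m^{-(k+1)} → 0, so the coefficients of
  -- degree at least 2 disappear.
  · have h2 : Tendsto (fun q => (fwdDiff 1)^[k + 2] (ρ q) 0 / δ q ^ (k + 2) * (m q)⁻¹ ^ (k + 1)) l
        (𝓝 (((k + 2).factorial : ℝ) * coeff (k + 2) G * 0 ^ (k + 1))) :=
      (hG (k + 2) hk).mul (hm.inv_tendsto_atTop.pow (k + 1))
    have h3 : coeff (k + 1 + 1) ((-κ) • (X : PowerSeries ℝ)) = 0 := by simp [coeff_X]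
    rw [h3, mul_zero]
    rw [zero_pow (by omega), mul_zero] at h2
    refine h2.congr' ?_
    filter_upwards [hm0] with q hmq
    rw [HasSymbol.iter_const_mul, mul_pow, pow_succ (m q) (k + 1), inv_pow]
    by_cases hd : δ q ^ (k + 1 + 1) = 0
    · simp [hd]
    · field_simp

/-- Zoomed and shifted, each summand has symbol -κX. The exponential then has symbol e^{κ(k+1)X},
whose N-th derivative at 0 is the limit. -/
theorem tendsto_fwdDiff_exp {δ m : ι → ℝ} {ρ : ι → ℕ → ℝ} {κ : ℝ}
    (hδ0 : ∀ᶠ q in l, δ q ≠ 0)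
    (hm : Tendsto m l atTop) (hmδ : Tendsto (fun q => m q * δ q) l (𝓝 0))
    (hρ : ∀ N, ∃ G, HasSymbol δ l N ρ G) (hρO : ∀ i, (fun q => ρ q i) =O[l] δ)
    (h0 : ∀ᶠ q in l, ρ q 0 = 0) (h1 : Tendsto (fun q => ρ q 1 / δ q) l (𝓝 (-κ))) (N k : ℕ) :
    Tendsto (fun q => (fwdDiff 1)^[N]
      (fun j => Real.exp (-(m q * ∑ t ∈ range (k + 1), ρ q (j + t)))) 0 / (m q * δ q) ^ N) l
      (𝓝 ((κ * (k + 1)) ^ N)) := by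
  have hm0 : ∀ᶠ q in l, m q * δ q ≠ 0 := by
    filter_upwards [hm.eventually_gt_atTop 0, hδ0] with q hq hq'
    exact mul_ne_zero hq.ne' hq'
  -- The summand shifted by t is taken to order N + t, since the shift costs t orders.
  have h2 : HasSymbol (fun q => m q * δ q) l N
      (fun q j => -1 * ∑ t ∈ range (k + 1), m q * ρ q (j + t))
      ((-1 : ℝ) • ∑ t ∈ range (k + 1), (-κ) • X) :=
    (HasSymbol.sum _ fun t _ =>
      (HasSymbol.zoom hm (hρ (N + t)) h0 h1).shift_add hmδ hm0 t).const_mul (-1)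
  have h3 := h2.comp_taylor hmδ hm0 (fun i => IsBigO.const_mul_left
    (IsBigO.fun_sum fun t _ => (isBigO_refl m l).mul (hρO _)) _) (Real.exp_taylor_isBigO N) N le_rfl
  have h4 : ((N.factorial : ℝ) * coeff N (∑ r ∈ range (N + 1), ((r.factorial : ℝ)⁻¹ •
      ((-1 : ℝ) • ∑ t ∈ range (k + 1), (-κ) • (X : PowerSeries ℝ)) ^ r))) =
      (κ * (k + 1)) ^ N := by
    have h5 : ((-1 : ℝ) • ∑ t ∈ range (k + 1), (-κ) • (X : PowerSeries ℝ)) = (κ * (k + 1)) • X := by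
      rw [Finset.sum_const, Finset.card_range, ← Nat.cast_smul_eq_nsmul ℝ, smul_smul, smul_smul]
      congr 1
      push_cast; ring
    rw [h5, map_sum, Finset.sum_eq_single N]
    · rw [map_smul, smul_pow, map_smul, coeff_X_pow_self, smul_eq_mul, smul_eq_mul, mul_one,
        mul_inv_cancel_left₀ (by positivity)]
    · intro r _ hr
      rw [map_smul, smul_pow, map_smul, coeff_X_pow, if_neg (Ne.symm hr), smul_zero, smul_zero]
    · simp
  rw [h4] at h3
  refine h3.congr fun q => ?_
  simp only [neg_one_mul, Finset.mul_sum, Finset.sum_neg_distrib]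

/-- The tree function coefficients from the semiclassical limit of the moment-cumulant recursion. -/
theorem tendsto_cumulant_of_fwdDiff {ε : ι → ℝ} {b x : ι → ℕ → ℝ} {κ : ℝ}
    (hε : ∀ᶠ q in l, ε q ≠ 0) (hb : ∀ n, ∀ᶠ q in l, b q n ≠ 0)
    (hH : ∀ k N, Tendsto (fun q => (fwdDiff 1)^[N] (fun j => b q j / b q (j + (k + 1))) 0 / ε q ^ N) l
      (𝓝 ((κ * (k + 1)) ^ N)))
    (hrec : ∀ n, ∀ᶠ q in l,
      b q (n + 1) = ∑ k ∈ range (n + 1), (n.choose k : ℝ) * (x q k * b q (n - k))) (n : ℕ) :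
    Tendsto (fun q => x q n / ε q ^ n) l (𝓝 ((-κ) ^ n * ((n : ℝ) + 1) ^ (n - 1))) := by
  induction n using Nat.strong_induction_on with
  | _ n ih =>
    -- This is the n-th difference at 0 of the constant function 1, written as the recursion divided
    -- by b_{i+1} and scaled by ε^n.
    have hid : ∀ᶠ q in l, ∑ k ∈ range (n + 1), (n.choose k : ℝ) * (x q k / ε q ^ k *
        ((fwdDiff 1)^[n - k] (fun j => b q j / b q (j + (k + 1))) 0 / ε q ^ (n - k))) =
        if n = 0 then 1 else 0 := by
      have h1 : ∀ᶠ q in l, ∀ i ∈ range (n + 1),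
          b q (i + 1) = ∑ k ∈ range (i + 1), (i.choose k : ℝ) * (x q k * b q (i - k)) :=
        (Filter.eventually_all_finset _).2 fun i _ => hrec i
      have h2 : ∀ᶠ q in l, ∀ i ∈ range (n + 1), b q (i + 1) ≠ 0 :=
        (Filter.eventually_all_finset _).2 fun i _ => hb (i + 1)
      filter_upwards [h1, h2, hε] with q hq1 hq2 hεq
      have h3 : ∀ i ≤ n, (1 : ℝ) = ∑ k ∈ range (n + 1), (i.choose k : ℝ) *
          (x q k * (fun j => b q j / b q (j + (k + 1))) (i - k)) := by
        intro i hi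
        have hi' := Finset.mem_range.2 (Nat.lt_succ_iff.2 hi)
        rw [← div_self (hq2 i hi')]
        -- The first rewrite expands numerator and denominator alike; the last one restores the
        -- denominator.
        conv_lhs => rw [hq1 i hi', Finset.sum_div, ← hq1 i hi']
        refine (Finset.sum_subset (Finset.range_subset_range.2 (by omega : i + 1 ≤ n + 1))
          fun k _ hk => ?_).trans (Finset.sum_congr rfl fun k hk => ?_)
        · rw [choose_mul_eq_zero_of_lt (by rw [Finset.mem_range] at hk; omega), zero_div]
        · rcases lt_or_ge i k with hik | hik
          · rw [choose_mul_eq_zero_of_lt hik, choose_mul_eq_zero_of_lt hik, zero_div]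
          · simp only [show i - k + (k + 1) = i + 1 by omega]; ring
      have h4 := fwdDiff_iter_zero_congr h3
      rw [fwdDiff_iter_sum_choose_mul (x q) (fun k j => b q j / b q (j + (k + 1)))] at h4
      have h5 : (fwdDiff 1)^[n] (fun _ : ℕ => (1 : ℝ)) 0 / ε q ^ n = if n = 0 then 1 else 0 := by
        rcases n with _ | n
        · simp
        · rw [fwdDiff_iter_one_succ]; simp
      rw [← h5, h4, Finset.sum_div]
      refine Finset.sum_congr rfl fun k hk => ?_
      have : ε q ^ n = ε q ^ k * ε q ^ (n - k) := by
        rw [← pow_add]; congr 1; have := Finset.mem_range.1 hk; omega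
      rw [this, mul_div_assoc, mul_div_mul_comm]
    have hsum : Tendsto (fun q => ∑ k ∈ range n, (n.choose k : ℝ) * (x q k / ε q ^ k *
        ((fwdDiff 1)^[n - k] (fun j => b q j / b q (j + (k + 1))) 0 / ε q ^ (n - k)))) l
        (𝓝 (∑ k ∈ range n, (n.choose k : ℝ) * ((-κ) ^ k * ((k : ℝ) + 1) ^ (k - 1) *
          (κ * (k + 1)) ^ (n - k)))) :=
      tendsto_finsetSum _ fun k hk => Tendsto.const_mul _
        ((ih k (Finset.mem_range.1 hk)).mul (hH k (n - k)))
    -- In the identity the term k = n is x_n/ε^n times b_0/b_{n+1}. This quotient tends to 1, so one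
    -- can solve for x_n/ε^n.
    have htop := hH n 0
    rw [pow_zero] at htop
    have hquot := ((tendsto_const_nhds (x := if n = 0 then (1 : ℝ) else 0)).sub hsum).div htop
      one_ne_zero
    have hval : ((if n = 0 then (1 : ℝ) else 0) - ∑ k ∈ range n, (n.choose k : ℝ) *
        ((-κ) ^ k * ((k : ℝ) + 1) ^ (k - 1) * (κ * (k + 1)) ^ (n - k))) / 1 =
        (-κ) ^ n * ((n : ℝ) + 1) ^ (n - 1) := by
      rw [div_one]
      rcases Nat.eq_zero_or_pos n with rfl | hn
      · simp
      · rw [if_neg hn.ne', zero_sub, neg_eq_iff_add_eq_zero]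
        -- The powers of k + 1 combine to (k+1)^(n-1). For k = 0 the truncated exponent k - 1 is
        -- harmless, the base being 1.
        have h6 := sum_alternating_choose_mul_add_pow 1 hn
        have h7 : ∀ k ∈ range (n + 1), (n.choose k : ℝ) *
            ((-κ) ^ k * ((k : ℝ) + 1) ^ (k - 1) * (κ * (k + 1)) ^ (n - k)) =
            κ ^ n * (((-1) ^ k * (n.choose k : ℝ)) * ((k : ℝ) + 1) ^ (n - 1)) := by
          intro k hk
          have hkn := Nat.lt_succ_iff.1 (Finset.mem_range.1 hk)
          have h8 : κ ^ n = κ ^ k * κ ^ (n - k) := by rw [← pow_add, Nat.add_sub_cancel' hkn]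
          have h9 : ((k : ℝ) + 1) ^ (k - 1) * ((k : ℝ) + 1) ^ (n - k) = ((k : ℝ) + 1) ^ (n - 1) := by
            rcases Nat.eq_zero_or_pos k with rfl | hk0
            · simp
            · rw [← pow_add]; congr 1; omega
          rw [h8, ← h9, mul_pow, neg_pow]
          ring
        have h10 : ∑ k ∈ range (n + 1), (n.choose k : ℝ) *
            ((-κ) ^ k * ((k : ℝ) + 1) ^ (k - 1) * (κ * (k + 1)) ^ (n - k)) = 0 := by
          rw [Finset.sum_congr rfl h7, ← Finset.mul_sum, h6, mul_zero]
        rw [Finset.sum_range_succ] at h10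
        simpa using h10
    rw [hval] at hquot
    refine hquot.congr' ?_
    filter_upwards [hid, hb 0, hb (n + 1)] with q hq h0 hn
    rw [← hq, Finset.sum_range_succ, Pi.div_apply, add_sub_cancel_left]
    simp only [Nat.choose_self, Nat.sub_self, Function.iterate_zero, id, pow_zero, div_one, zero_add,
      Nat.cast_one, one_mul]
    exact mul_div_cancel_right₀ _ (div_ne_zero h0 hn)

end

/-! ### Newton's identities and the coefficients of the convolutions -/

section

/-- Newton's identities for symmetric polynomials in d variables, evaluated at an enumeration of the
multiset. -/
theorem Multiset.succ_mul_esymm_succ (s : Multiset ℝ) (i : ℕ) :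
    ((i : ℝ) + 1) * s.esymm (i + 1) =
      ∑ k ∈ Finset.range (i + 1), (-1) ^ k * (s.map fun x => x ^ (k + 1)).sum * s.esymm (i - k) := by
  obtain ⟨d, f, rfl⟩ : ∃ (d : ℕ) (f : Fin d → ℝ), s = Finset.univ.val.map f := by
    obtain ⟨t, rfl⟩ := Quot.exists_rep s
    exact ⟨t.length, t.get, by simp [Fin.univ_val_map]⟩
  have h := congrArg (MvPolynomial.aeval f) (MvPolynomial.mul_esymm_eq_sum (Fin d) ℝ (i + 1))
  simp only [map_mul, map_natCast, map_sum, map_pow, map_neg, map_one,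
    MvPolynomial.aeval_esymm_eq_multiset_esymm, MvPolynomial.psum, MvPolynomial.aeval_X] at h
  push_cast at h
  rw [h, Finset.sum_filter, Finset.Nat.sum_antidiagonal_eq_sum_range_succ_mk, Finset.sum_range_succ,
    if_neg (by simp), add_zero, Finset.mul_sum, ← Finset.sum_range_reflect]
  refine Finset.sum_congr rfl fun k hk => ?_
  have hki : k ≤ i := Nat.lt_succ_iff.1 (Finset.mem_range.1 hk)
  have h1 : i + 1 - 1 - k = i - k := by omega
  have h2 : i + 1 - (i - k) = k + 1 := by omega
  rw [h1, if_pos (by omega), h2, Multiset.map_map]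
  have h3 : (-1 : ℝ) ^ (i + 1 + 1) * (-1) ^ (i - k) = (-1) ^ k := by
    obtain ⟨t, rfl⟩ := Nat.exists_eq_add_of_le hki
    rw [Nat.add_sub_cancel_left, ← pow_add, show k + t + 1 + 1 + t = k + 2 * (t + 1) by ring, pow_add,
      pow_mul]
    simp
  rw [← h3]
  simp only [Finset.sum_map_val, Function.comp_def]
  ring

namespace FiniteFree

open Polynomial Finset

theorem normCoeff_zero {d : ℕ} {p : ℝ[X]} (hp : IsMonicNonnegRooted d p) : normCoeff d p 0 = 1 := by
  have := hp.monic.coeff_natDegree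
  rw [hp.natDegree_eq] at this
  simp [normCoeff, this]

theorem choose_mul_normCoeff {d : ℕ} {p : ℝ[X]} (hp : IsMonicNonnegRooted d p) {i : ℕ}
    (hi : i ≤ d) : (d.choose i : ℝ) * normCoeff d p i = p.roots.esymm i := by
  have h := p.coeff_eq_esymm_roots_of_splits hp.splits (k := d - i) (by rw [hp.natDegree_eq]; omega)
  rw [hp.natDegree_eq, hp.monic.leadingCoeff, Nat.sub_sub_self hi, one_mul] at h
  have h0 : (d.choose i : ℝ) ≠ 0 := by exact_mod_cast (Nat.choose_pos hi).ne'
  rw [normCoeff, h]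
  have h1 : ((-1 : ℝ) ^ i) * (-1) ^ i = 1 := by rw [← mul_pow]; simp
  field_simp
  linear_combination p.roots.esymm i * h1

/-- Coefficients of a polynomial given by its normalized coefficients. -/
theorem normCoeff_sum {d i : ℕ} (hi : i ≤ d) (a : ℕ → ℝ) :
    normCoeff d (∑ k ∈ range (d + 1), C ((-1) ^ k * (d.choose k : ℝ) * a k) * X ^ (d - k)) i =
      a i := by
  rw [normCoeff, finsetSum_coeff, Finset.sum_eq_single i]
  · rw [coeff_C_mul, coeff_X_pow_self, mul_one]
    have h0 : (d.choose i : ℝ) ≠ 0 := by exact_mod_cast (Nat.choose_pos hi).ne'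
    have h1 : ((-1 : ℝ) ^ i) * (-1) ^ i = 1 := by rw [← mul_pow]; simp
    field_simp
    linear_combination a i * h1
  · intro k hk hki
    have := Finset.mem_range.1 hk
    rw [coeff_C_mul, coeff_X_pow, if_neg (by omega), mul_zero]
  · intro h
    exact absurd (Finset.mem_range.2 (by omega)) h

theorem normCoeff_mulConv {d i : ℕ} (hi : i ≤ d) (p q : ℝ[X]) :
    normCoeff d (mulConv d p q) i = normCoeff d p i * normCoeff d q i := by
  rw [mulConv, ← normCoeff_sum hi (fun i => normCoeff d p i * normCoeff d q i)]
  simp only [mul_assoc]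

theorem normCoeff_mulConvPow {d i : ℕ} (hi : i ≤ d) (p : ℝ[X]) (m : ℕ) :
    normCoeff d (mulConvPow d p m) i = normCoeff d p i ^ m := by
  induction m with
  | zero =>
    have h0 : (d.choose i : ℝ) ≠ 0 := by exact_mod_cast (Nat.choose_pos hi).ne'
    have h1 : ((-1 : ℝ) ^ i) * (-1) ^ i = 1 := by rw [← mul_pow]; simp
    have h2 : (X - 1 : ℝ[X]) = X + C (-1) := by simp [sub_eq_add_neg]
    rw [mulConvPow, normCoeff, h2, coeff_X_add_C_pow, Nat.sub_sub_self hi, Nat.choose_symm hi]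
    field_simp
    simpa [sq] using h1
  | succ m ih => rw [mulConvPow, normCoeff_mulConv hi, ih, pow_succ]

theorem normCoeff_addConv {d i : ℕ} (hi : i ≤ d) (p q : ℝ[X]) :
    normCoeff d (addConv d p q) i = ∑ ij ∈ Finset.HasAntidiagonal.antidiagonal i,
      ((i.factorial : ℝ) / ((ij.1.factorial : ℝ) * (ij.2.factorial : ℝ))) *
        normCoeff d p ij.1 * normCoeff d q ij.2 :=
  normCoeff_sum hi _

/-- In degrees up to d, ⊞_d is the product of the exponential generating functions of the normalized
coefficients. -/
theorem normCoeff_addConvPow {d i : ℕ} (hi : i ≤ d) (p : ℝ[X]) (m : ℕ) :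
    normCoeff d (addConvPow d p m) i = (i.factorial : ℝ) *
      PowerSeries.coeff i ((PowerSeries.mk fun j => normCoeff d p j / (j.factorial : ℝ)) ^ m) := by
  induction m generalizing i with
  | zero =>
    rw [addConvPow, normCoeff, coeff_X_pow, pow_zero, PowerSeries.coeff_one]
    rcases Nat.eq_zero_or_pos i with rfl | h
    · simp
    · rw [if_neg (by omega), if_neg (by omega)]; simp
  | succ m ih =>
    rw [addConvPow, normCoeff_addConv hi, pow_succ, PowerSeries.coeff_mul, Finset.mul_sum]
    refine Finset.sum_congr rfl fun ij hij => ?_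
    have := Finset.HasAntidiagonal.mem_antidiagonal.1 hij
    rw [ih (by omega), PowerSeries.coeff_mk]
    have h1 : ((ij.1.factorial : ℕ) : ℝ) ≠ 0 := by positivity
    have h2 : ((ij.2.factorial : ℕ) : ℝ) ≠ 0 := by positivity
    field_simp

theorem normCoeff_dilate {d i : ℕ} (hi : i ≤ d) {c : ℝ} (hc : c ≠ 0) (p : ℝ[X]) :
    normCoeff d (dilate d c p) i = c ^ i * normCoeff d p i := by
  rw [normCoeff, normCoeff, dilate, coeff_C_mul, comp_C_mul_X_coeff]
  have : c ^ d = c ^ i * c ^ (d - i) := by rw [← pow_add, Nat.add_sub_cancel' hi]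
  rw [this, inv_pow]
  have : c ^ (d - i) ≠ 0 := pow_ne_zero _ hc
  field_simp

/-- The cumulants of `D_{1/m}((p^{⊠ m})^{⊞ m})` in terms of the powers of the coefficients of `p`. -/
theorem cumulant_dilate_addConvPow_mulConvPow {d n m : ℕ} (hn : n + 1 ≤ d) (hm : m ≠ 0) {p : ℝ[X]}
    (hp : IsMonicNonnegRooted d p) :
    cumulant d (n + 1) (dilate d (1 / (m : ℝ)) (addConvPow d (mulConvPow d p m) m)) =
      (-1) ^ n / (n.factorial : ℝ) *
        (logCumulant (fun i => normCoeff d p i ^ m) (n + 1) / (m * (d : ℝ)⁻¹) ^ n) := by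
  have hm' : (m : ℝ) ≠ 0 := by exact_mod_cast hm
  have hd' : (d : ℝ) ≠ 0 := by have : d ≠ 0 := by omega
                               exact_mod_cast this
  set A : PowerSeries ℝ := PowerSeries.mk fun j => normCoeff d (mulConvPow d p m) j / (j.factorial : ℝ)
    with hA
  have h1 : logCumulant (normCoeff d (dilate d (1 / (m : ℝ)) (addConvPow d (mulConvPow d p m) m)))
      (n + 1) = logCumulant (fun i => (1 / (m : ℝ)) ^ i *
        ((i.factorial : ℝ) * PowerSeries.coeff i (A ^ m))) (n + 1) :=
    logCumulant_congr fun k _ hk => by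
      rw [normCoeff_dilate (hk.trans hn) (by simpa using hm), normCoeff_addConvPow (hk.trans hn)]
  have hA1 : PowerSeries.constantCoeff A = 1 := by
    simp [hA, normCoeff_mulConvPow (Nat.zero_le d), normCoeff_zero hp]
  have h2 : logCumulant (fun i => (i.factorial : ℝ) * PowerSeries.coeff i A) (n + 1) =
      logCumulant (fun i => normCoeff d p i ^ m) (n + 1) :=
    logCumulant_congr fun k _ hk => by
      have : ((k.factorial : ℕ) : ℝ) ≠ 0 := by positivity
      rw [hA, PowerSeries.coeff_mk, mul_div_cancel₀ _ this, normCoeff_mulConvPow (hk.trans hn)]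
  -- Dilation contributes m^{-(n+1)} and the additive power contributes m, leaving m^{-n} to pair
  -- with d^n.
  rw [cumulant_eq_logCumulant, h1, logCumulant_scale, logCumulant_egf_pow hA1, h2,
    Nat.add_sub_cancel, neg_pow (d : ℝ), mul_pow, inv_pow, one_div, inv_pow, pow_succ (m : ℝ)]
  field_simp

/-- The power sum means of the roots. -/
def rootMoment (d : ℕ) (p : ℝ[X]) (k : ℕ) : ℝ := (d : ℝ)⁻¹ * (p.roots.map fun x => x ^ k).sum

theorem integral_sum_map_dirac (s : Multiset ℝ) (f : ℝ → ℝ) :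
    Integrable f (s.map Measure.dirac).sum ∧
      ∫ x, f x ∂(s.map Measure.dirac).sum = (s.map f).sum := by
  induction s using Multiset.induction_on with
  | empty => simp
  | cons a s ih =>
    have ha : Integrable f (Measure.dirac a) := integrable_dirac (by finiteness)
    rw [Multiset.map_cons, Multiset.sum_cons, Multiset.map_cons, Multiset.sum_cons,
      integral_add_measure ha ih.1, integral_dirac, ih.2]
    exact ⟨ha.add_measure ih.1, rfl⟩

theorem moment_empiricalRootMeasure (d : ℕ) (p : ℝ[X]) (k : ℕ) :
    FreeProb.moment (empiricalRootMeasure d p) k = rootMoment d p k := by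
  rw [FreeProb.moment, empiricalRootMeasure, integral_smul_measure,
    (integral_sum_map_dirac _ _).2, rootMoment]
  simp

/-- The descending-factorial normalization `(d)_i d^{-i} ã_i(p)`. -/
def powerSumCoeff (d : ℕ) (p : ℝ[X]) (i : ℕ) : ℝ :=
  (d.descFactorial i : ℝ) * (d : ℝ)⁻¹ ^ i * normCoeff d p i

/-- In this normalization the coefficient is i! d^{-i} e_i(roots), so Newton's identities turn into
a cumulant recursion with k-th cumulant of order d^{-k}, as `SmallCumulants` demands. -/
theorem powerSumCoeff_succ {d : ℕ} {p : ℝ[X]} (hp : IsMonicNonnegRooted d p) {i : ℕ} (hi : i + 1 ≤ d) :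
    powerSumCoeff d p (i + 1) = ∑ k ∈ range (i + 1), (i.choose k : ℝ) *
      (((-1) ^ k * (k.factorial : ℝ) * rootMoment d p (k + 1) * (d : ℝ)⁻¹ ^ k) *
        powerSumCoeff d p (i - k)) := by
  have h1 : ∀ j ≤ d, powerSumCoeff d p j = (j.factorial : ℝ) * (d : ℝ)⁻¹ ^ j * p.roots.esymm j := by
    intro j hj
    rw [← choose_mul_normCoeff hp hj, powerSumCoeff, Nat.descFactorial_eq_factorial_mul_choose]
    push_cast; ring
  rw [h1 _ hi, Nat.factorial_succ]
  have h2 := p.roots.succ_mul_esymm_succ i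
  push_cast
  calc _ = (i.factorial : ℝ) * (d : ℝ)⁻¹ ^ (i + 1) * (((i : ℝ) + 1) * p.roots.esymm (i + 1)) := by ring
    _ = _ := by
      rw [h2, Finset.mul_sum]
      refine Finset.sum_congr rfl fun k hk => ?_
      have hki : k ≤ i := Nat.lt_succ_iff.1 (Finset.mem_range.1 hk)
      have h3 : (i.choose k : ℝ) * (k.factorial : ℝ) * ((i - k).factorial : ℝ) = i.factorial := by
        exact_mod_cast Nat.choose_mul_factorial_mul_factorial hki
      have h4 : (d : ℝ)⁻¹ ^ (i + 1) = (d : ℝ)⁻¹ ^ k * (d : ℝ)⁻¹ ^ (i - k) * (d : ℝ)⁻¹ := by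
        rw [← pow_add, Nat.add_sub_cancel' hki, pow_succ]
      rw [h1 _ (by omega), ← h3, h4, rootMoment]
      ring

end FiniteFree

end

/-! ### Finite free cumulants in the sparse regime -/

section

open Finset Asymptotics

variable {ι : Type*} {l : Filter ι}

theorem tendsto_log_one_add_div {δ y : ι → ℝ} {c : ℝ} (hδ : Tendsto δ l (𝓝 0))
    (hδ0 : ∀ᶠ q in l, δ q ≠ 0) (hy : Tendsto (fun q => y q / δ q) l (𝓝 c)) :
    Tendsto (fun q => Real.log (1 + y q) / δ q) l (𝓝 c) := by
  have h0 : HasDerivAt (fun x : ℝ => Real.log (1 + x)) 1 0 := by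
    simpa using ((hasDerivAt_id (0 : ℝ)).const_add 1).log (by simp)
  have hyO : y =O[l] δ := by
    have := (hy.isBigO_one ℝ).mul (isBigO_refl δ l)
    simp only [one_mul] at this
    exact this.congr' (hδ0.mono fun q hq => div_mul_cancel₀ _ hq) EventuallyEq.rfl
  have hy0 : Tendsto y l (𝓝 0) := hyO.trans_tendsto hδ
  have h1 : (fun q => Real.log (1 + y q) - y q) =o[l] δ := by
    have := (h0.isLittleO.comp_tendsto hy0).trans_isBigO (by simpa [Function.comp_def] using hyO)
    simpa [Function.comp_def] using this
  have h2 := h1.tendsto_div_nhds_zero.add hy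
  rw [zero_add] at h2
  exact h2.congr fun q => by rw [← add_div, sub_add_cancel]

theorem hasSymbol_linear {δ : ι → ℝ} (hδ0 : ∀ᶠ q in l, δ q ≠ 0) (N : ℕ) :
    HasSymbol δ l N (fun q i => -(δ q * i)) (-PowerSeries.X) := by
  refine HasSymbol.mono (N := N + 1) (HasSymbol.succ_iff.2 ⟨by simpa using tendsto_const_nhds, ?_⟩)
    N.le_succ
  refine ((HasSymbol.const (-1)).congr fun i _ => ?_).congr_symbol fun k _ => ?_
  · filter_upwards [hδ0] with q hq
    push_cast; field_simp; ring
  · simp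

namespace FiniteFree

section

variable {p : ℕ → Polynomial ℝ} (hp : ∀ d, 1 ≤ d → IsMonicNonnegRooted d (p d))
  (hmean : ∀ d, 1 ≤ d → normCoeff d (p d) 1 = 1) {M : ℕ → ℝ}
  (hM : ∀ k, Tendsto (fun d => rootMoment d (p d) k) atTop (𝓝 (M k)))
  {d : ι → ℕ} (hd : Tendsto d l atTop)

include hp hmean hM hd

theorem smallCumulants_powerSumCoeff :
    SmallCumulants (fun q => (d q : ℝ)⁻¹) l (fun q => powerSumCoeff (d q) (p (d q)))
      (fun q k => (-1) ^ k * (k.factorial : ℝ) * rootMoment (d q) (p (d q)) (k + 1) *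
        (d q : ℝ)⁻¹ ^ k) := by
  have hd1 : ∀ᶠ q in l, 1 ≤ d q := hd.eventually_ge_atTop 1
  have hd0 : ∀ᶠ q in l, (d q : ℝ)⁻¹ ≠ 0 := hd1.mono fun q hq => by
    have : d q ≠ 0 := by omega
    exact inv_ne_zero (by exact_mod_cast this)
  have hinit : ∀ e, 1 ≤ e → powerSumCoeff e (p e) 0 = 1 := fun e he => by
    simp [powerSumCoeff, normCoeff_zero (hp e he)]
  refine ⟨tendsto_inv_atTop_zero.comp (tendsto_natCast_atTop_atTop.comp hd), hd0,
    hd1.mono fun q hq => hinit _ hq, ?_, fun k => ?_, fun n => ?_⟩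
  · filter_upwards [hd1] with q hq
    have h1 := powerSumCoeff_succ (hp _ hq) (i := 0) (by omega)
    have h2 : (d q : ℝ) ≠ 0 := by
      have : d q ≠ 0 := by omega
      exact_mod_cast this
    simp only [zero_add, Finset.sum_range_one, powerSumCoeff, hmean _ hq,
      Nat.sub_zero] at h1
    simpa [h2, normCoeff_zero (hp _ hq)] using h1.symm
  · refine ⟨(-1) ^ k * (k.factorial : ℝ) * M (k + 1), (((hM (k + 1)).comp hd).const_mul
      ((-1) ^ k * (k.factorial : ℝ))).congr' ?_⟩
    filter_upwards [hd0] with q hq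
    rw [mul_div_cancel_right₀ _ (pow_ne_zero _ hq)]
    rfl
  · filter_upwards [hd.eventually_ge_atTop (n + 1)] with q hq
    exact powerSumCoeff_succ (hp _ (by omega)) hq

theorem eventually_normCoeff_pos (i : ℕ) : ∀ᶠ q in l, 0 < normCoeff (d q) (p (d q)) i := by
  have h := smallCumulants_powerSumCoeff hp hmean hM hd
  filter_upwards [(h.tendsto_one i).eventually_const_lt one_pos, hd.eventually_ge_atTop (i + 1)]
    with q hq hi
  have h1 : (0 : ℝ) < d q := by exact_mod_cast (by omega : 0 < d q)
  have h2 : (0 : ℝ) < (d q).descFactorial i := by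
    exact_mod_cast Nat.pos_of_ne_zero fun h0 => by
      rw [Nat.descFactorial_eq_zero_iff_lt] at h0; omega
  exact pos_of_mul_pos_right hq (by positivity)

/-- Consecutive factors (d)_i d^{-i} have quotient 1 - i/d. Subtracting its logarithm transfers the
expansion from `powerSumCoeff` to `normCoeff`. -/
theorem eventually_log_normCoeff_ratio (i : ℕ) : ∀ᶠ q in l,
    Real.log (powerSumCoeff (d q) (p (d q)) (i + 1) / powerSumCoeff (d q) (p (d q)) i) +
      -1 * Real.log (1 + -((d q : ℝ)⁻¹ * i)) =
      Real.log (normCoeff (d q) (p (d q)) (i + 1) / normCoeff (d q) (p (d q)) i) := by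
  filter_upwards [hd.eventually_ge_atTop (i + 1), eventually_normCoeff_pos hp hmean hM hd i,
    eventually_normCoeff_pos hp hmean hM hd (i + 1)] with q hq h1 h2
  have h3 : (0 : ℝ) < d q := by exact_mod_cast (by omega : 0 < d q)
  have h4 : (0 : ℝ) < (d q).descFactorial i := by
    exact_mod_cast Nat.pos_of_ne_zero fun h0 => by
      rw [Nat.descFactorial_eq_zero_iff_lt] at h0; omega
  have h5 : (0 : ℝ) < 1 + -((d q : ℝ)⁻¹ * i) := by
    have : (i : ℝ) < d q := by exact_mod_cast (by omega : i < d q)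
    have := (div_lt_one h3).2 this
    rw [div_eq_inv_mul] at this
    linarith
  have h6 : powerSumCoeff (d q) (p (d q)) (i + 1) / powerSumCoeff (d q) (p (d q)) i =
      (1 + -((d q : ℝ)⁻¹ * i)) *
        (normCoeff (d q) (p (d q)) (i + 1) / normCoeff (d q) (p (d q)) i) := by
    rw [powerSumCoeff, powerSumCoeff, Nat.descFactorial_succ, Nat.cast_mul,
      Nat.cast_sub (by omega), pow_succ]
    field_simp
    ring
  rw [h6, Real.log_mul h5.ne' (div_pos h2 h1).ne']
  ring

theorem exists_hasSymbol_log_normCoeff_ratio (N : ℕ) :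
    ∃ G, HasSymbol (fun q => (d q : ℝ)⁻¹) l N
      (fun q i => Real.log (normCoeff (d q) (p (d q)) (i + 1) / normCoeff (d q) (p (d q)) i)) G := by
  have h := smallCumulants_powerSumCoeff hp hmean hM hd
  obtain ⟨R, hR⟩ := h.exists_hasSymbol_log_ratio N
  obtain ⟨t, ht⟩ := (show AnalyticAt ℝ (fun x : ℝ => Real.log (1 + x)) 0 from
      (analyticAt_const.add analyticAt_id).log (by simp)).exists_taylor_isBigO
  have h1 := (hasSymbol_linear h.ne_zero N).comp_taylor h.tendsto h.ne_zero
    (fun i => by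
      simpa [mul_comm] using (isBigO_refl (fun q => (d q : ℝ)⁻¹) l).const_mul_left (i : ℝ)) (ht N)
  exact ⟨_, (hR.add (h1.const_mul (-1))).congr fun i _ =>
    eventually_log_normCoeff_ratio hp hmean hM hd i⟩

theorem log_normCoeff_ratio_isBigO (i : ℕ) :
    (fun q => Real.log (normCoeff (d q) (p (d q)) (i + 1) / normCoeff (d q) (p (d q)) i)) =O[l]
      fun q => (d q : ℝ)⁻¹ := by
  have h := smallCumulants_powerSumCoeff hp hmean hM hd
  have h1 : (fun q => -((d q : ℝ)⁻¹ * i)) =O[l] fun q => (d q : ℝ)⁻¹ := by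
    simpa [mul_comm] using (isBigO_refl (fun q => (d q : ℝ)⁻¹) l).const_mul_left (i : ℝ)
  have h2 := (SmallCumulants.log_one_add_isBigO.comp_tendsto (h1.trans_tendsto h.tendsto)).trans h1
  exact ((h.log_ratio_isBigO i).add (h2.const_mul_left (-1))).congr'
    (eventually_log_normCoeff_ratio hp hmean hM hd i) EventuallyEq.rfl

omit hM in
theorem eventually_log_normCoeff_ratio_zero : ∀ᶠ q in l,
    Real.log (normCoeff (d q) (p (d q)) (0 + 1) / normCoeff (d q) (p (d q)) 0) = 0 := by
  filter_upwards [hd.eventually_ge_atTop 1] with q hq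
  rw [zero_add, hmean _ hq, normCoeff_zero (hp _ hq)]
  simp

/-- This limit is the linear coefficient of the symbol. With mean one, Newton's identities give
a_2/a_1 = 1 - m_2/d, and removing log(1 - 1/d) adds 1/d to the logarithm. What remains is minus the
limiting variance. -/
theorem tendsto_log_normCoeff_ratio_one : Tendsto (fun q =>
    Real.log (normCoeff (d q) (p (d q)) (1 + 1) / normCoeff (d q) (p (d q)) 1) / (d q : ℝ)⁻¹) l
      (𝓝 (-(M 2 - 1))) := by
  have h := smallCumulants_powerSumCoeff hp hmean hM hd
  have h1 : Tendsto (fun q => (powerSumCoeff (d q) (p (d q)) 2 / powerSumCoeff (d q) (p (d q)) 1 - 1) /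
      (d q : ℝ)⁻¹) l (𝓝 (-M 2)) := by
    refine (((hM 2).comp hd).neg).congr' ?_
    filter_upwards [h.recursion 0, h.recursion 1, h.init, h.mean, h.ne_zero] with q h1 h2 h3 h4 h5
    simp only [zero_add, Finset.sum_range_one, Nat.choose_self, Nat.cast_one, one_mul, h4,
      Nat.sub_self, h3] at h1
    rw [h2, Finset.sum_range_succ, Finset.sum_range_one, h4, Nat.sub_zero, Nat.sub_self, h1, h3,
      Function.comp_apply]
    have : (d q : ℝ) ≠ 0 := fun h0 => h5 (by rw [h0, inv_zero])
    simp [this]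
  have h2 : Tendsto (fun q => -((d q : ℝ)⁻¹ * (1 : ℕ)) / (d q : ℝ)⁻¹) l (𝓝 (-1)) :=
    tendsto_const_nhds.congr' (h.ne_zero.mono fun q hq => by
      simp only [Nat.cast_one, mul_one, neg_div, div_self hq])
  have h3 := (tendsto_log_one_add_div h.tendsto h.ne_zero h1).sub
    (tendsto_log_one_add_div h.tendsto h.ne_zero h2)
  rw [show -M 2 - -1 = -(M 2 - 1) by ring] at h3
  refine h3.congr' ?_
  filter_upwards [eventually_log_normCoeff_ratio hp hmean hM hd 1] with q hq
  rw [← hq, ← sub_div, add_sub_cancel]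
  ring

theorem tendsto_cumulant_sparse {m : ι → ℕ} (hm : Tendsto m l atTop)
    (hmd : Tendsto (fun q => (m q : ℝ) / (d q : ℝ)) l (𝓝 0)) (n : ℕ) :
    Tendsto (fun q => cumulant (d q) (n + 1) (dilate (d q) (1 / (m q : ℝ))
      (addConvPow (d q) (mulConvPow (d q) (p (d q)) (m q)) (m q)))) l
      (𝓝 (((M 2 - 1) * ((n : ℝ) + 1)) ^ n / ((n + 1).factorial : ℝ))) := by
  have h := smallCumulants_powerSumCoeff hp hmean hM hd
  have hm' : Tendsto (fun q => (m q : ℝ)) l atTop := tendsto_natCast_atTop_atTop.comp hm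
  have hε : ∀ᶠ q in l, (m q : ℝ) * (d q : ℝ)⁻¹ ≠ 0 := by
    filter_upwards [hm'.eventually_gt_atTop 0, h.ne_zero] with q hq hq'
    exact mul_ne_zero hq.ne' hq'
  have hpos := eventually_normCoeff_pos hp hmean hM hd
  have hH : ∀ k N, Tendsto (fun q => (fwdDiff 1)^[N] (fun j => normCoeff (d q) (p (d q)) j ^ m q /
      normCoeff (d q) (p (d q)) (j + (k + 1)) ^ m q) 0 / ((m q : ℝ) * (d q : ℝ)⁻¹) ^ N) l
      (𝓝 (((M 2 - 1) * (k + 1)) ^ N)) := by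
    intro k N
    refine (tendsto_fwdDiff_exp h.ne_zero hm' (by simpa only [div_eq_mul_inv] using hmd)
      (exists_hasSymbol_log_normCoeff_ratio hp hmean hM hd)
      (log_normCoeff_ratio_isBigO hp hmean hM hd)
      (eventually_log_normCoeff_ratio_zero hp hmean hd)
      (tendsto_log_normCoeff_ratio_one hp hmean hM hd) N k).congr' ?_
    have h1 : ∀ᶠ q in l, ∀ i ∈ range (N + k + 2), 0 < normCoeff (d q) (p (d q)) i :=
      (Filter.eventually_all_finset _).2 fun i _ => hpos i
    filter_upwards [h1] with q hq
    congr 1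
    refine fwdDiff_iter_zero_congr fun j hj => ?_
    have h4 : 0 < normCoeff (d q) (p (d q)) j := hq _ (Finset.mem_range.2 (by omega))
    have h2 : ∀ t ≤ k + 1, 0 < normCoeff (d q) (p (d q)) (j + t) := fun t ht =>
      hq _ (Finset.mem_range.2 (by omega))
    have h3 : ∑ t ∈ range (k + 1), Real.log (normCoeff (d q) (p (d q)) (j + t + 1) /
        normCoeff (d q) (p (d q)) (j + t)) = Real.log (normCoeff (d q) (p (d q)) (j + (k + 1))) -
          Real.log (normCoeff (d q) (p (d q)) j) := by
      refine Eq.trans ?_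
        (Finset.sum_range_sub (fun t => Real.log (normCoeff (d q) (p (d q)) (j + t))) (k + 1))
      refine Finset.sum_congr rfl fun t ht => ?_
      have := Finset.mem_range.1 ht
      exact Real.log_div (h2 (t + 1) (by omega)).ne' (h2 t (by omega)).ne'
    -- The telescoped sum of logarithms exponentiates to the quotient of coefficients, raised to the
    -- power m.
    rw [h3, ← mul_neg, neg_sub, ← Real.log_div h4.ne' (h2 (k + 1) le_rfl).ne',
      Real.exp_nat_mul, Real.exp_log (div_pos h4 (h2 (k + 1) le_rfl)), div_pow]
  have hlim := tendsto_cumulant_of_fwdDiff (b := fun q j => normCoeff (d q) (p (d q)) j ^ m q)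
    (x := fun q k => logCumulant (fun i => normCoeff (d q) (p (d q)) i ^ m q) (k + 1))
    hε (fun n => (hpos n).mono fun q hq => pow_ne_zero _ hq.ne') hH (fun n => by
      filter_upwards [hd.eventually_ge_atTop 1] with q hq
      rw [logCumulant_recursion (a := fun i => normCoeff (d q) (p (d q)) i ^ m q)
        (by simp [normCoeff_zero (hp _ hq)])]
      exact Finset.sum_congr rfl fun k _ => by ring) n
  have hlim2 := hlim.const_mul ((-1) ^ n / (n.factorial : ℝ))
  -- The signs cancel, and (n+1)^(n-1)/n! = (n+1)^n/(n+1)!. The truncated exponent makes n = 0 a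
  -- separate case.
  have hval : (-1) ^ n / (n.factorial : ℝ) * ((-(M 2 - 1)) ^ n * ((n : ℝ) + 1) ^ (n - 1)) =
      ((M 2 - 1) * ((n : ℝ) + 1)) ^ n / ((n + 1).factorial : ℝ) := by
    have h1 : ((n.factorial : ℕ) : ℝ) ≠ 0 := by positivity
    have h2 : (n : ℝ) + 1 ≠ 0 := by positivity
    rw [neg_pow (M 2 - 1), mul_pow, Nat.factorial_succ]
    push_cast
    have h3 : ((-1 : ℝ) ^ n) * (-1) ^ n = 1 := by rw [← mul_pow]; simp
    rcases n with _ | n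
    · simp
    · rw [Nat.add_sub_cancel, pow_succ (((n + 1 : ℕ) : ℝ) + 1) n]
      field_simp
      linear_combination ((M 2 - 1) ^ (n + 1)) * h3
  rw [hval] at hlim2
  refine hlim2.congr' ?_
  filter_upwards [hd.eventually_ge_atTop (n + 1), hm.eventually_ge_atTop 1] with q hq hmq
  rw [cumulant_dilate_addConvPow_mulConvPow hq (by omega) (hp _ (by omega))]

end

end FiniteFree

end

/-! ### Coefficientwise limits and inversion of formal power series -/

section

namespace PowerSeries

open Finset

variable {ι : Type*} {l : Filter ι}

theorem tendsto_coeff_mul {A B : ι → PowerSeries ℝ} {A₀ B₀ : PowerSeries ℝ} {n : ℕ}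
    (hA : ∀ i ≤ n, Tendsto (fun q => coeff i (A q)) l (𝓝 (coeff i A₀)))
    (hB : ∀ i ≤ n, Tendsto (fun q => coeff i (B q)) l (𝓝 (coeff i B₀))) :
    Tendsto (fun q => coeff n (A q * B q)) l (𝓝 (coeff n (A₀ * B₀))) := by
  simp only [coeff_mul]
  refine tendsto_finsetSum _ fun ij hij => ?_
  have := Finset.HasAntidiagonal.mem_antidiagonal.1 hij
  exact (hA _ (by omega)).mul (hB _ (by omega))

theorem tendsto_coeff_pow {A : ι → PowerSeries ℝ} {A₀ : PowerSeries ℝ} {n : ℕ} (k : ℕ)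
    (hA : ∀ i ≤ n, Tendsto (fun q => coeff i (A q)) l (𝓝 (coeff i A₀))) :
    Tendsto (fun q => coeff n (A q ^ k)) l (𝓝 (coeff n (A₀ ^ k))) := by
  induction k generalizing n with
  | zero => simpa using tendsto_const_nhds
  | succ k ih =>
    simp only [pow_succ]
    exact tendsto_coeff_mul (fun i hi => ih fun j hj => hA j (hj.trans hi)) hA

theorem coeff_pow_congr {A B : PowerSeries ℝ} {n : ℕ} (k : ℕ)
    (h : ∀ i ≤ n, coeff i A = coeff i B) : coeff n (A ^ k) = coeff n (B ^ k) := by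
  induction k generalizing n with
  | zero => simp
  | succ k ih =>
    rw [pow_succ, pow_succ, coeff_mul, coeff_mul]
    refine Finset.sum_congr rfl fun ij hij => ?_
    have := Finset.HasAntidiagonal.mem_antidiagonal.1 hij
    rw [ih fun j hj => h j (by omega), h _ (by omega)]

theorem coeff_subst_X_mul (R S : PowerSeries ℝ) (n : ℕ) :
    coeff n (R.subst (X * S)) =
      ∑ k ∈ range (n + 1), coeff k R * coeff (n - k) (S ^ k) := by
  have hs : HasSubst (X * S) := HasSubst.of_constantCoeff_zero' (by simp)
  have hc : ∀ k, coeff n ((X * S) ^ k) = if k ≤ n then coeff (n - k) (S ^ k) else 0 := by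
    intro k
    rw [mul_pow, coeff_X_pow_mul']
  rw [coeff_subst' hs, finsum_eq_sum_of_support_subset (s := range (n + 1))]
  · refine Finset.sum_congr rfl fun k hk => ?_
    rw [hc, if_pos (Nat.lt_succ_iff.1 (Finset.mem_range.1 hk)), smul_eq_mul]
  · intro k hk
    rw [Finset.mem_coe, Finset.mem_range]
    by_contra h
    rw [Function.mem_support, hc, if_neg (by omega), smul_zero] at hk
    exact hk rfl

theorem coeff_one_mul_coeff_zero_of_subst_eq_X {R S : PowerSeries ℝ} (h : R.subst (X * S) = X) :
    coeff 1 R * coeff 0 S = 1 := by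
  have h1 := congrArg (coeff 1) h
  rw [coeff_subst_X_mul, Finset.sum_range_succ, Finset.sum_range_one] at h1
  simpa [coeff_one_X, coeff_one] using h1

/-- The coefficient of z^(n+1) in R(zS) is R_1 S_n plus terms in lower coefficients of S, and R_1 ≠
0. Uniqueness is needed because `IsFreeMulConv` supplies S-transforms only existentially. -/
theorem eq_of_subst_X_mul_eq_X {R S T : PowerSeries ℝ} (hS : R.subst (X * S) = X)
    (hT : R.subst (X * T) = X) : S = T := by
  have hR : coeff 1 R ≠ 0 := left_ne_zero_of_mul_eq_one (coeff_one_mul_coeff_zero_of_subst_eq_X hS)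
  ext n
  induction n using Nat.strong_induction_on with
  | _ n ih =>
    have h := congrArg (coeff (n + 1)) (hS.trans hT.symm)
    rw [coeff_subst_X_mul, coeff_subst_X_mul, Finset.sum_range_succ', Finset.sum_range_succ',
      Finset.sum_range_succ', Finset.sum_range_succ'] at h
    have h1 : ∀ k ∈ range n, coeff (k + 1 + 1) R * coeff (n + 1 - (k + 1 + 1)) (S ^ (k + 1 + 1)) =
        coeff (k + 1 + 1) R * coeff (n + 1 - (k + 1 + 1)) (T ^ (k + 1 + 1)) := fun k hk => by
      have := Finset.mem_range.1 hk
      rw [coeff_pow_congr _ fun j hj => ih j (by omega)]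
    rw [Finset.sum_congr rfl h1] at h
    simpa [hR] using h

/-- Rescaled powers of a series with constant coefficient `1` converge to an exponential. -/
theorem tendsto_coeff_rescale_pow {G : PowerSeries ℝ} (hG : constantCoeff G = 1) (j : ℕ) :
    Tendsto (fun m : ℕ => coeff j (rescale (m : ℝ)⁻¹ (G ^ m))) atTop
      (𝓝 (coeff j (rescale (coeff 1 G) (exp ℝ)))) := by
  have hB : constantCoeff (G - 1) = 0 := by simp [hG]
  -- Binomial expansion of (1 + (G - 1))^m. In the limit C(m,i) m^{-i} → 1/i!, while m^{-(j-i)}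
  -- kills every term except i = j.
  have h1 : ∀ m : ℕ, coeff j (rescale (m : ℝ)⁻¹ (G ^ m)) =
      ∑ i ∈ range (j + 1), (m.choose i * (m : ℝ)⁻¹ ^ i) * (m : ℝ)⁻¹ ^ (j - i) *
        coeff j ((G - 1) ^ i) := by
    intro m
    have h2 : coeff j (G ^ m) = ∑ i ∈ range (j + 1), (m.choose i : ℝ) * coeff j ((G - 1) ^ i) := by
      conv_lhs => rw [← sub_add_cancel G 1, add_pow, map_sum]
      have h3 : ∀ i, coeff j ((G - 1) ^ i * 1 ^ (m - i) * (m.choose i : PowerSeries ℝ)) =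
          (m.choose i : ℝ) * coeff j ((G - 1) ^ i) := by
        intro i
        rw [one_pow, mul_one, mul_comm, ← nsmul_eq_mul, map_nsmul, nsmul_eq_mul]
      simp only [h3]
      rcases le_total m j with h | h
      · refine Finset.sum_subset (Finset.range_subset_range.2 (by omega)) fun i _ hi => ?_
        rw [Nat.choose_eq_zero_of_lt (by rw [Finset.mem_range] at hi; omega)]; simp
      · refine (Finset.sum_subset (Finset.range_subset_range.2 (by omega)) fun i _ hi => ?_).symm
        rw [SetPartition.coeff_pow_eq_zero hB (by rw [Finset.mem_range] at hi; omega), mul_zero]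
    rw [coeff_rescale, h2, Finset.mul_sum]
    refine Finset.sum_congr rfl fun i hi => ?_
    have := Nat.lt_succ_iff.1 (Finset.mem_range.1 hi)
    rw [show (m : ℝ)⁻¹ ^ j = (m : ℝ)⁻¹ ^ i * (m : ℝ)⁻¹ ^ (j - i) by
      rw [← pow_add, Nat.add_sub_cancel' this]]
    ring
  simp only [h1]
  have hinv : Tendsto (fun m : ℕ => (m : ℝ)⁻¹) atTop (𝓝 0) := tendsto_inv_atTop_nhds_zero_nat
  have hch : ∀ i, Tendsto (fun m : ℕ => (m.choose i * (m : ℝ)⁻¹ ^ i : ℝ)) atTop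
      (𝓝 (1 ^ i / (i.factorial : ℝ))) := fun i =>
    ProbabilityTheory.tendsto_choose_mul_pow_atTop i (tendsto_const_nhds.congr' (by
      filter_upwards [eventually_ge_atTop 1] with m hm
      have : (m : ℝ) ≠ 0 := by
        have : m ≠ 0 := by omega
        exact_mod_cast this
      rw [mul_inv_cancel₀ this]))
  have h4 := tendsto_finsetSum (range (j + 1)) fun i _ =>
    ((hch i).mul (hinv.pow (j - i))).mul_const (coeff j ((G - 1) ^ i))
  have h5 : (∑ i ∈ range (j + 1), 1 ^ i / (i.factorial : ℝ) * 0 ^ (j - i) * coeff j ((G - 1) ^ i)) =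
      coeff j (rescale (coeff 1 G) (exp ℝ)) := by
    rw [Finset.sum_eq_single j]
    · have h6 : coeff j ((G - 1) ^ j) = coeff 1 G ^ j := by
        obtain ⟨D, hD⟩ := X_dvd_iff.2 hB
        have h7 : coeff 1 G = constantCoeff D := by
          have := congrArg (coeff 1) hD
          rw [← zero_add 1, coeff_succ_X_mul] at this
          simpa [coeff_one] using this
        rw [hD, mul_pow, coeff_X_pow_mul', if_pos le_rfl, Nat.sub_self, h7]
        simp
      rw [h6, coeff_rescale, coeff_exp]
      simp
      ring
    · intro i hi hij
      have := Finset.mem_range.1 hi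
      rw [zero_pow (by omega)]; simp
    · simp
  rw [h5] at h4
  exact h4

theorem coeff_rescale_exp_pow (g : ℝ) (k j : ℕ) :
    coeff j (rescale g (exp ℝ) ^ k) = (g * k) ^ j / (j.factorial : ℝ) := by
  rw [← map_pow, exp_pow_eq_rescale_exp, coeff_rescale, coeff_rescale, coeff_exp, mul_pow]
  simp
  ring

/-- If `Q(z H(z)) = z` and `H → e^{-α z}` coefficientwise, then the coefficients of `Q` converge
to those of the tree function. -/
theorem tendsto_coeff_of_inverse {α : ℝ} {Q H : ι → PowerSeries ℝ}
    (hQ0 : ∀ q, coeff 0 (Q q) = 0) (hH0 : ∀ᶠ q in l, coeff 0 (H q) = 1)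
    (hH : ∀ j, Tendsto (fun q => coeff j (H q)) l (𝓝 (coeff j (rescale (-α) (exp ℝ)))))
    (hQ : ∀ᶠ q in l, ∀ n, ∑ k ∈ range (n + 1), coeff k (Q q) * coeff (n - k) (H q ^ k) =
      coeff n (X : PowerSeries ℝ)) (n : ℕ) :
    Tendsto (fun q => coeff n (Q q)) l
      (𝓝 (if n = 0 then 0 else (α * n) ^ (n - 1) / (n.factorial : ℝ))) := by
  induction n using Nat.strong_induction_on with
  | _ n ih =>
    rcases Nat.eq_zero_or_pos n with rfl | hn
    · simpa only [hQ0, if_true] using tendsto_const_nhds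
    have hsum : Tendsto (fun q => coeff n (X : PowerSeries ℝ) -
        ∑ k ∈ range n, coeff k (Q q) * coeff (n - k) (H q ^ k)) l
        (𝓝 (coeff n (X : PowerSeries ℝ) - ∑ k ∈ range n,
          (if k = 0 then 0 else (α * k) ^ (k - 1) / (k.factorial : ℝ)) *
            coeff (n - k) (rescale (-α) (exp ℝ) ^ k))) :=
      tendsto_const_nhds.sub (tendsto_finsetSum _ fun k hk =>
        (ih k (Finset.mem_range.1 hk)).mul (tendsto_coeff_pow k fun i _ => hH i))
    have hval : coeff n (X : PowerSeries ℝ) - ∑ k ∈ range n,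
        (if k = 0 then 0 else (α * k) ^ (k - 1) / (k.factorial : ℝ)) *
          coeff (n - k) (rescale (-α) (exp ℝ) ^ k) =
        if n = 0 then 0 else (α * n) ^ (n - 1) / (n.factorial : ℝ) := by
      rw [if_neg hn.ne']
      rcases (by omega : n = 1 ∨ 2 ≤ n) with rfl | hn2
      · simp [coeff_one_X]
      · rw [coeff_X, if_neg (by omega), zero_sub, neg_eq_iff_add_eq_zero]
        -- The limiting recursion says T(z e^{-αz}) = z for the tree function T; up to a common
        -- factor it is an alternating binomial sum. The absent term k = 0 matches 0^(n-1) = 0,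
        -- which requires n ≥ 2.
        have h1 := sum_alternating_choose_mul_add_pow 0 hn
        have h2 : ∀ k ∈ range (n + 1),
            (if k = 0 then 0 else (α * k) ^ (k - 1) / (k.factorial : ℝ)) *
              coeff (n - k) (rescale (-α) (exp ℝ) ^ k) = (-1) ^ n * α ^ (n - 1) / (n.factorial : ℝ) *
              (((-1) ^ k * (n.choose k : ℝ)) * ((k : ℝ) + 0) ^ (n - 1)) := by
          intro k hk
          have hkn := Nat.lt_succ_iff.1 (Finset.mem_range.1 hk)
          rw [coeff_rescale_exp_pow, add_zero]
          rcases Nat.eq_zero_or_pos k with rfl | hk0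
          · rw [if_pos rfl, Nat.cast_zero, zero_pow (by omega : n - 1 ≠ 0)]; ring
          · obtain ⟨t, rfl⟩ := Nat.exists_eq_add_of_le hkn
            obtain ⟨k, rfl⟩ : ∃ k', k = k' + 1 := ⟨k - 1, by omega⟩
            have h3 : ((k + 1 + t).choose (k + 1) : ℝ) * ((k + 1).factorial : ℝ) *
                (t.factorial : ℝ) = ((k + 1 + t).factorial : ℝ) := by
              have := Nat.choose_mul_factorial_mul_factorial hkn
              rw [Nat.add_sub_cancel_left] at this
              exact_mod_cast this
            have h4 : ((-1 : ℝ) ^ (k + 1)) * (-1) ^ (k + 1) = 1 := by rw [← mul_pow]; simp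
            have h5 : (((k + 1).factorial : ℕ) : ℝ) ≠ 0 := by positivity
            have h6 : ((t.factorial : ℕ) : ℝ) ≠ 0 := by positivity
            have h7 : ((k + 1 + t).choose (k + 1) : ℝ) ≠ 0 := by
              exact_mod_cast (Nat.choose_pos hkn).ne'
            rw [if_neg (by omega), Nat.add_sub_cancel_left, Nat.add_sub_cancel,
              show k + 1 + t - 1 = k + t by omega, ← h3]
            have h8 : (-α * ((k + 1 : ℕ) : ℝ)) ^ t =
                ((-1) ^ (k + 1) * (-1) ^ (k + 1)) * (-α * ((k + 1 : ℕ) : ℝ)) ^ t := by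
              rw [h4, one_mul]
            rw [h8, neg_mul, neg_pow (α * _), mul_pow, mul_pow, pow_add (-1 : ℝ) (k + 1) t]
            field_simp
            ring
        have h3 := Finset.sum_congr rfl h2
        rw [← Finset.mul_sum, h1, mul_zero, Finset.sum_range_succ, if_neg hn.ne',
          coeff_rescale_exp_pow, Nat.sub_self, pow_zero, Nat.factorial_zero, Nat.cast_one, div_one,
          mul_one] at h3
        exact h3
    rw [hval] at hsum
    refine hsum.congr' ?_
    filter_upwards [hQ, hH0] with q hq h0
    have h1 : coeff 0 (H q ^ n) = 1 := by
      rw [coeff_zero_eq_constantCoeff_apply] at h0 ⊢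
      rw [map_pow, h0, one_pow]
    rw [← hq n, Finset.sum_range_succ, Nat.sub_self, h1, mul_one, add_sub_cancel_left]

end PowerSeries

end

/-! ### Free cumulants, S-transforms and moments of weak limits -/

section

namespace FreeProb

open Finset PowerSeries

theorem moment_zero (μ : Measure ℝ) [IsProbabilityMeasure μ] : moment μ 0 = 1 := by
  simp [moment]

theorem freeCumulant_zero (μ : Measure ℝ) : freeCumulant μ 0 = 0 := by
  rw [freeCumulant]

theorem freeCumulant_succ (μ : Measure ℝ) (n : ℕ) :
    freeCumulant μ (n + 1) = moment μ (n + 1) - ∑ s ∈ range n, freeCumulant μ (s + 1) *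
      coeff (n - s) (momentSeries μ ^ (s + 1)) := by
  rw [freeCumulant, Finset.sum_range fun s => freeCumulant μ (s + 1) *
      coeff (n - s) (momentSeries μ ^ (s + 1))]

theorem freeCumulant_one (μ : Measure ℝ) : freeCumulant μ 1 = moment μ 1 := by
  rw [freeCumulant_succ, Finset.sum_range_zero, sub_zero]

theorem freeCumulant_two (μ : Measure ℝ) :
    freeCumulant μ 2 = moment μ 2 - moment μ 1 ^ 2 := by
  rw [freeCumulant_succ, Finset.sum_range_one, zero_add, freeCumulant_one, pow_one, momentSeries,
    coeff_mk, Nat.sub_zero, sq]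

theorem moment_dilateMeasure (c : ℝ) (μ : Measure ℝ) (n : ℕ) :
    moment (dilateMeasure c μ) n = c ^ n * moment μ n := by
  rw [moment, dilateMeasure, integral_map (by fun_prop) (by fun_prop), moment, ← integral_const_mul]
  simp only [mul_pow]

theorem momentSeries_dilateMeasure (c : ℝ) (μ : Measure ℝ) :
    momentSeries (dilateMeasure c μ) = rescale c (momentSeries μ) := by
  ext n
  rw [coeff_rescale, momentSeries, momentSeries, coeff_mk, coeff_mk, moment_dilateMeasure]

theorem freeCumulant_dilateMeasure (c : ℝ) (μ : Measure ℝ) (n : ℕ) :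
    freeCumulant (dilateMeasure c μ) n = c ^ n * freeCumulant μ n := by
  induction n using Nat.strong_induction_on with
  | _ n ih =>
    rcases n with _ | n
    · simp [freeCumulant_zero]
    · rw [freeCumulant_succ, freeCumulant_succ, moment_dilateMeasure, mul_sub, Finset.mul_sum]
      congr 1
      refine Finset.sum_congr rfl fun s hs => ?_
      have := Finset.mem_range.1 hs
      rw [ih _ (by omega), momentSeries_dilateMeasure, ← map_pow, coeff_rescale,
        show c ^ (n + 1) = c ^ (s + 1) * c ^ (n - s) by rw [← pow_add]; congr 1; omega]
      ring

theorem moment_dirac (x : ℝ) (n : ℕ) : moment (Measure.dirac x) n = x ^ n := by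
  rw [moment, integral_dirac]

theorem RTransform_dirac_zero : RTransform (Measure.dirac 0) = 0 := by
  ext n
  rw [RTransform, coeff_mk, map_zero]
  induction n using Nat.strong_induction_on with
  | _ n ih =>
    rcases n with _ | n
    · simp [freeCumulant_zero]
    · rw [freeCumulant_succ, moment_dirac, zero_pow n.succ_ne_zero, zero_sub, neg_eq_zero]
      refine Finset.sum_eq_zero fun s hs => ?_
      have := Finset.mem_range.1 hs
      rw [ih _ (by omega), zero_mul]

theorem RTransform_dirac_one : RTransform (Measure.dirac 1) = X := by
  ext n
  rw [RTransform, coeff_mk, coeff_X]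
  induction n using Nat.strong_induction_on with
  | _ n ih =>
    rcases n with _ | _ | n
    · simp [freeCumulant_zero]
    · simp [freeCumulant_one, moment_dirac]
    · rw [freeCumulant_succ, moment_dirac, one_pow, if_neg (by omega), Finset.sum_eq_single 0]
      · rw [ih _ (by omega), if_pos rfl, zero_add, pow_one, momentSeries, coeff_mk, moment_dirac]
        simp
      · intro s hs hs0
        have := Finset.mem_range.1 hs
        rw [ih _ (by omega), if_neg (by omega), zero_mul]
      · simp

theorem IsFreeAddPow.rTransform {μ : Measure ℝ} {m : ℕ} {ρ : Measure ℝ} (h : IsFreeAddPow μ m ρ) :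
    RTransform ρ = m • RTransform μ := by
  induction m generalizing ρ with
  | zero => rw [show ρ = Measure.dirac 0 from h, RTransform_dirac_zero, zero_smul]
  | succ m ih =>
    obtain ⟨τ, h1, h2⟩ := h
    rw [h2.rTransform, ih h1, succ_nsmul]

theorem IsFreeAddPow.isCompactProb {μ : Measure ℝ} {m : ℕ} (hm : 1 ≤ m) {ρ : Measure ℝ}
    (h : IsFreeAddPow μ m ρ) : IsCompactProb ρ := by
  obtain ⟨m, rfl⟩ : ∃ k, m = k + 1 := ⟨m - 1, by omega⟩
  obtain ⟨τ, _, h2⟩ := h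
  exact h2.conv

theorem IsFreeMulPow.isSTransform {μ : Measure ℝ} {S : PowerSeries ℝ} (hS : IsSTransform μ S)
    {m : ℕ} {ρ : Measure ℝ} (h : IsFreeMulPow μ m ρ) : IsSTransform ρ (S ^ m) := by
  induction m generalizing ρ with
  | zero =>
    rw [show ρ = Measure.dirac 1 from h, IsSTransform, RTransform_dirac_one, pow_zero, mul_one,
      subst_X HasSubst.X']
  | succ m ih =>
    obtain ⟨τ, h1, h2⟩ := h
    obtain ⟨S', T, hS', hT, hST⟩ := h2.sTransform
    rwa [eq_of_subst_X_mul_eq_X hS' (ih h1), eq_of_subst_X_mul_eq_X hT hS, ← pow_succ] at hST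

theorem IsCompactProb.integrable_pow {μ : Measure ℝ} (h : IsCompactProb μ) (n : ℕ) :
    Integrable (fun x : ℝ => x ^ n) μ := by
  have := h.prob
  obtain ⟨K, hK, hμ⟩ := h.compact
  obtain ⟨B, hB⟩ := hK.isBounded.exists_norm_le
  refine Integrable.of_bound (by fun_prop) (B ^ n) ?_
  have : ∀ᵐ x ∂μ, x ∈ K := by rw [ae_iff]; exact hμ
  filter_upwards [this] with x hx
  rw [norm_pow]
  exact pow_le_pow_left₀ (norm_nonneg _) (hB x hx) n

theorem integrable_pow_dilateMeasure {μ : Measure ℝ} {n : ℕ} (c : ℝ)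
    (h : Integrable (fun x : ℝ => x ^ n) μ) :
    Integrable (fun x : ℝ => x ^ n) (dilateMeasure c μ) := by
  rw [dilateMeasure, integrable_map_measure (by fun_prop) (by fun_prop)]
  simp only [Function.comp_def, mul_pow]
  exact h.const_mul _

section Limits

variable {ι : Type*} {l : Filter ι} {ρ : ι → Measure ℝ}

/-- The moment-cumulant relation is triangular, so it can be solved for the moments one after
another. -/
theorem exists_tendsto_moment (hprob : ∀ᶠ q in l, IsProbabilityMeasure (ρ q))
    (hκ : ∀ n, ∃ c, Tendsto (fun q => freeCumulant (ρ q) n) l (𝓝 c)) (n : ℕ) :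
    ∃ M, Tendsto (fun q => moment (ρ q) n) l (𝓝 M) := by
  induction n using Nat.strong_induction_on with
  | _ n ih =>
    rcases n with _ | n
    · exact ⟨1, tendsto_const_nhds.congr' (hprob.mono fun q _ => (moment_zero _).symm)⟩
    · choose! M hM using ih
      choose c hc using hκ
      refine ⟨_, ((hc (n + 1)).add (tendsto_finsetSum (range n) fun s hs => (hc (s + 1)).mul
        (tendsto_coeff_pow (n := n - s) (s + 1) (A := fun q => momentSeries (ρ q))
          (A₀ := PowerSeries.mk M) fun i hi => ?_))).congr fun q => ?_⟩
      · simpa [momentSeries] using hM i (by omega)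
      · rw [freeCumulant_succ, sub_add_cancel]

theorem tendsto_freeCumulant {η : Measure ℝ}
    (hm : ∀ n, Tendsto (fun q => moment (ρ q) n) l (𝓝 (moment η n))) (n : ℕ) :
    Tendsto (fun q => freeCumulant (ρ q) n) l (𝓝 (freeCumulant η n)) := by
  induction n using Nat.strong_induction_on with
  | _ n ih =>
    rcases n with _ | n
    · simpa [freeCumulant_zero] using tendsto_const_nhds
    · rw [freeCumulant_succ]
      refine ((hm (n + 1)).sub (tendsto_finsetSum (range n) fun s hs => (ih (s + 1)
        (by have := Finset.mem_range.1 hs; omega)).mul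
        (tendsto_coeff_pow (s + 1) fun i _ => ?_))).congr fun q => (freeCumulant_succ (ρ q) n).symm
      simpa [momentSeries] using hm i

end Limits

/-- The truncation of `f` to `[-R, R]` as a bounded continuous function. -/
def truncation (f : C(ℝ, ℝ)) (R : ℝ) : BoundedContinuousFunction ℝ ℝ :=
  BoundedContinuousFunction.ofNormedAddCommGroup (fun x => max (-R) (min (f x) R)) (by fun_prop) |R|
    fun x => by
      rw [Real.norm_eq_abs, abs_le]
      constructor
      · exact (neg_le_neg (le_abs_self R)).trans (le_max_left _ _)
      · exact max_le (neg_le_abs R) ((min_le_right _ _).trans (le_abs_self R))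

/-- The two functions differ only where |f| > R, and there |f| ≤ f²/R. Second moments therefore
control the truncation error. -/
theorem abs_sub_truncation_le (f : C(ℝ, ℝ)) {R : ℝ} (hR : 0 < R) (x : ℝ) :
    |f x - truncation f R x| ≤ f x ^ 2 / R := by
  show |f x - max (-R) (min (f x) R)| ≤ _
  rw [le_div_iff₀ hR]
  rcases le_total (f x) R with h1 | h1
  · rw [min_eq_left h1]
    rcases le_total (-R) (f x) with h2 | h2
    · rw [max_eq_right h2, sub_self, abs_zero, zero_mul]; positivity
    · rw [max_eq_left h2, abs_of_nonpos (by linarith)]; nlinarith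
  · rw [min_eq_right h1, max_eq_right (by linarith), abs_of_nonneg (by linarith)]; nlinarith

theorem abs_integral_sub_truncation_le {μ : Measure ℝ} [IsProbabilityMeasure μ] (f : C(ℝ, ℝ)) {R : ℝ}
    (hR : 0 < R) (hf : Integrable f μ) (hf2 : Integrable (fun x => f x ^ 2) μ) :
    |∫ x, f x ∂μ - ∫ x, truncation f R x ∂μ| ≤ (∫ x, f x ^ 2 ∂μ) / R := by
  rw [← integral_sub hf ((truncation f R).integrable μ), ← integral_div]
  exact norm_integral_le_of_norm_le (f := fun x => f x - truncation f R x) (hf2.div_const R)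
    (Eventually.of_forall fun x => abs_sub_truncation_le f hR x)

/-- Weak limits of probability measures with convergent moments have the limit moments. -/
theorem moment_of_weakTendsto {ρ : ℕ → Measure ℝ} {η : Measure ℝ} [IsProbabilityMeasure η]
    (hprob : ∀ᶠ m in atTop, IsProbabilityMeasure (ρ m))
    (hint : ∀ k, ∀ᶠ m in atTop, Integrable (fun x : ℝ => x ^ k) (ρ m))
    (hw : WeakTendsto ρ atTop η) {M : ℕ → ℝ}
    (hM : ∀ k, Tendsto (fun m => moment (ρ m) k) atTop (𝓝 (M k))) (k : ℕ) :
    Integrable (fun x : ℝ => x ^ k) η ∧ moment η k = M k := by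
  -- Even moments come first, since positivity gives bounds. On [-n, n] the truncation at n^(2j)
  -- changes nothing, and its integral is a limit of integrals bounded by convergent moments.
  have hsq : ∀ j, Integrable (fun x : ℝ => x ^ (2 * j)) η := by
    intro j
    let f : C(ℝ, ℝ) := ⟨fun x => x ^ (2 * j), by fun_prop⟩
    refine (aecover_Icc (μ := η) (l := atTop) (a := fun n : ℕ => -(n : ℝ)) (b := fun n : ℕ => (n : ℝ))
      (tendsto_neg_atTop_atBot.comp tendsto_natCast_atTop_atTop)
      tendsto_natCast_atTop_atTop).integrable_of_integral_bounded_of_nonneg_ae (M (2 * j))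
      (fun n => (by fun_prop : Continuous fun x : ℝ => x ^ (2 * j)).continuousOn.integrableOn_Icc)
      (Eventually.of_forall fun x => (even_two_mul j).pow_nonneg x) (Eventually.of_forall fun n => ?_)
    have hnn : ∀ x : ℝ, 0 ≤ truncation f ((n : ℝ) ^ (2 * j)) x := fun x =>
      le_max_of_le_right (le_min ((even_two_mul j).pow_nonneg x) (by positivity))
    have h1 : ∫ x in Set.Icc (-(n : ℝ)) n, x ^ (2 * j) ∂η ≤
        ∫ x, truncation f ((n : ℝ) ^ (2 * j)) x ∂η := by
      refine le_trans (b := ∫ x in Set.Icc (-(n : ℝ)) n, truncation f ((n : ℝ) ^ (2 * j)) x ∂η)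
        (le_of_eq ?_) (setIntegral_le_integral ((truncation f _).integrable η)
        (Eventually.of_forall hnn))
      refine setIntegral_congr_fun measurableSet_Icc fun x hx => ?_
      have h2 : x ^ (2 * j) ≤ (n : ℝ) ^ (2 * j) := by
        rw [← (even_two_mul j).pow_abs]
        exact pow_le_pow_left₀ (abs_nonneg x) (abs_le.2 hx) _
      have h3 : 0 ≤ x ^ (2 * j) := (even_two_mul j).pow_nonneg x
      show x ^ (2 * j) = max (-(n : ℝ) ^ (2 * j)) (min (x ^ (2 * j)) ((n : ℝ) ^ (2 * j)))
      rw [min_eq_left h2, max_eq_right (by linarith)]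
    refine h1.trans (le_of_tendsto_of_tendsto (hw _) (hM (2 * j)) ?_)
    filter_upwards [hprob, hint (2 * j)] with m _ hm2
    refine integral_mono ((truncation f _).integrable _) hm2 fun x => ?_
    have h3 : 0 ≤ x ^ (2 * j) := (even_two_mul j).pow_nonneg x
    exact max_le (by have : (0 : ℝ) ≤ (n : ℝ) ^ (2 * j) := by positivity
                     linarith) (min_le_left _ _)
  have hpow : ∀ j, Integrable (fun x : ℝ => x ^ j) η := fun j =>
    ((integrable_const (1 : ℝ)).add (hsq j)).mono' (by fun_prop) (Eventually.of_forall fun x => by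
      show |x ^ j| ≤ 1 + x ^ (2 * j)
      rw [mul_comm, pow_mul, abs_le]
      constructor <;> nlinarith [sq_nonneg (x ^ j - 1), sq_nonneg (x ^ j + 1)])
  refine ⟨hpow k, ?_⟩
  let f : C(ℝ, ℝ) := ⟨fun x => x ^ k, by fun_prop⟩
  have hfsq : (fun x => f x ^ 2) = fun x : ℝ => x ^ (2 * k) := by
    ext x; rw [mul_comm 2 k, pow_mul]; rfl
  -- The truncation error for the approximating measures is bounded through their moments of order
  -- 2k, and the bound survives the limit at fixed R. Only afterwards does R tend to infinity.
  have h1 : ∀ R : ℝ, 0 < R → |M k - ∫ x, truncation f R x ∂η| ≤ M (2 * k) / R := by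
    intro R hR
    refine le_of_tendsto_of_tendsto (((hM k).sub (hw (truncation f R))).abs)
      ((hM (2 * k)).div_const R) ?_
    filter_upwards [hprob, hint k, hint (2 * k)] with m _ h2 h3
    have := abs_integral_sub_truncation_le (μ := ρ m) f hR h2 (hfsq ▸ h3)
    rw [hfsq] at this
    exact this
  have h2 : ∀ R : ℝ, 0 < R → |moment η k - ∫ x, truncation f R x ∂η| ≤ moment η (2 * k) / R := by
    intro R hR
    have := abs_integral_sub_truncation_le (μ := η) f hR (hpow k) (hfsq ▸ hsq k)
    rw [hfsq] at this
    exact this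
  have h3 : ∀ᶠ R : ℝ in atTop, |moment η k - M k| ≤ (moment η (2 * k) + M (2 * k)) / R := by
    filter_upwards [eventually_gt_atTop 0] with R hR
    rw [add_div]
    calc _ = |(moment η k - ∫ x, truncation f R x ∂η) - (M k - ∫ x, truncation f R x ∂η)| := by
          congr 1; ring
      _ ≤ _ := (abs_sub _ _).trans (add_le_add (h2 R hR) (h1 R hR))
  have h4 : |moment η k - M k| ≤ 0 :=
    ge_of_tendsto (tendsto_const_nhds.div_atTop tendsto_id) h3
  exact sub_eq_zero.1 (abs_nonpos_iff.1 h4)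

/-- Free cumulants are first computed in the limit along the approximating measures, by inverting
their S-transforms. They are then carried to η through the convergence of moments. -/
theorem sakumaYoshida_freeCumulant {α : ℝ} {η : Measure ℝ} (h : IsSakumaYoshidaLimit α η) :
    (∀ k : ℕ, Integrable (fun x : ℝ => x ^ k) η) ∧
      ∀ n : ℕ, 1 ≤ n → freeCumulant η n = (α * (n : ℝ)) ^ (n - 1) / (n.factorial : ℝ) := by
  obtain ⟨hη, ν, hν, hα, σ, ρ, hσ, hρ, hw⟩ := h
  -- The S-transform of ν is read off from the first multiplicative power, in which ν is a factor.
  obtain ⟨S, hS⟩ : ∃ S, IsSTransform ν S := by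
    obtain ⟨τ, _, h2⟩ := hσ 1 le_rfl
    obtain ⟨_, T, _, hT, _⟩ := h2.sTransform
    exact ⟨T, hT⟩
  set s : ℝ := 1 / moment ν 1 with hs
  set η' : ℕ → Measure ℝ := fun m => dilateMeasure (s ^ m / (m : ℝ)) (ρ m) with hη'
  have hS0 : moment ν 1 * coeff 0 S = 1 := by
    have := coeff_one_mul_coeff_zero_of_subst_eq_X hS
    rwa [RTransform, coeff_mk, freeCumulant_one] at this
  have hm1 : moment ν 1 ≠ 0 := left_ne_zero_of_mul_eq_one hS0
  have hs0 : s ≠ 0 := by rw [hs]; exact one_div_ne_zero hm1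
  have hS0' : coeff 0 S = s := by rw [hs]; field_simp; linarith
  -- The coefficient of z^2 in R(zS(z)) = z. It yields -α as the linear coefficient of the
  -- normalized series G.
  have hS1 : moment ν 1 * coeff 1 S + freeCumulant ν 2 * s ^ 2 = 0 := by
    have h1 := congrArg (coeff 2) hS
    have h2 : coeff 0 (S ^ 2) = s ^ 2 := by
      rw [coeff_zero_eq_constantCoeff_apply, map_pow, ← coeff_zero_eq_constantCoeff_apply, hS0']
    rw [coeff_subst_X_mul, Finset.sum_range_succ, Finset.sum_range_succ, Finset.sum_range_one,
      RTransform, coeff_mk, coeff_mk, coeff_mk, freeCumulant_one, coeff_X, if_neg (by omega),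
      Nat.sub_self, pow_one, h2] at h1
    simpa [freeCumulant_zero] using h1
  obtain ⟨G, hG⟩ : ∃ G : PowerSeries ℝ, G = s⁻¹ • S := ⟨_, rfl⟩
  have hSG : S = s • G := by rw [hG, smul_smul, mul_inv_cancel₀ hs0, one_smul]
  have hG0 : constantCoeff G = 1 := by
    rw [← coeff_zero_eq_constantCoeff_apply, hG, map_smul, hS0', smul_eq_mul, inv_mul_cancel₀ hs0]
  have hG1 : coeff 1 G = -α := by
    rw [hG, map_smul, smul_eq_mul, ← hα, ← freeCumulant_two]
    have h1 : coeff 1 S = -(freeCumulant ν 2 * s ^ 2) / moment ν 1 := by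
      field_simp; linarith
    rw [h1, hs]
    field_simp
  -- With Q(z) = m R_σ(s^m z/m) and s^m G^m = S^m, substituting z G(z/m)^m gives m R_σ(w S(w)^m) at
  -- w = z/m, which is mw = z.
  have hQ : ∀ m, 1 ≤ m → ∀ n, ∑ k ∈ range (n + 1), coeff k (RTransform (η' m)) *
      coeff (n - k) (rescale (m : ℝ)⁻¹ (G ^ m) ^ k) = coeff n (X : PowerSeries ℝ) := by
    intro m hm n
    have hm' : (m : ℝ) ≠ 0 := by
      have : m ≠ 0 := by omega
      exact_mod_cast this
    have h1 := congrArg (coeff n) ((hσ m hm).isSTransform hS)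
    rw [coeff_subst_X_mul] at h1
    have h2 : ∀ k, coeff k (RTransform (η' m)) =
        (s ^ m / m) ^ k * (m * coeff k (RTransform (σ m))) := by
      intro k
      have := congrArg (coeff k) (hρ m hm).rTransform
      rw [map_nsmul, nsmul_eq_mul] at this
      rw [← this, RTransform, RTransform, coeff_mk, coeff_mk, hη', freeCumulant_dilateMeasure]
    have h3 : ∀ k ∈ range (n + 1), coeff k (RTransform (η' m)) *
        coeff (n - k) (rescale (m : ℝ)⁻¹ (G ^ m) ^ k) =
        m * (m : ℝ)⁻¹ ^ n * (coeff k (RTransform (σ m)) * coeff (n - k) ((S ^ m) ^ k)) := by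
      intro k hk
      have hkn := Nat.lt_succ_iff.1 (Finset.mem_range.1 hk)
      rw [h2, ← map_pow, coeff_rescale, hSG, smul_pow, smul_pow, map_smul, smul_eq_mul, div_pow,
        show (m : ℝ)⁻¹ ^ n = (m : ℝ)⁻¹ ^ k * (m : ℝ)⁻¹ ^ (n - k) by
          rw [← pow_add, Nat.add_sub_cancel' hkn], inv_pow _ k]
      ring
    rw [Finset.sum_congr rfl h3, ← Finset.mul_sum, h1, coeff_X]
    split_ifs with hn
    · rw [hn, pow_one, mul_one, mul_inv_cancel₀ hm']
    · rw [mul_zero]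
  have hκ : ∀ n, Tendsto (fun m => freeCumulant (η' m) n) atTop
      (𝓝 (if n = 0 then 0 else (α * n) ^ (n - 1) / (n.factorial : ℝ))) := by
    intro n
    have := tendsto_coeff_of_inverse (l := atTop) (α := α) (Q := fun m => RTransform (η' m))
      (H := fun m : ℕ => rescale (m : ℝ)⁻¹ (G ^ m)) (fun m => by simp [RTransform, freeCumulant_zero])
      (Eventually.of_forall fun m => by
        rw [coeff_rescale, coeff_zero_eq_constantCoeff_apply, map_pow, hG0]; simp)
      (fun j => hG1 ▸ tendsto_coeff_rescale_pow hG0 j)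
      ((eventually_ge_atTop 1).mono fun m hm => hQ m hm) n
    simpa only [RTransform, coeff_mk] using this
  have hprob : ∀ᶠ m in atTop, IsProbabilityMeasure (η' m) := by
    filter_upwards [eventually_ge_atTop 1] with m hm
    have := ((hρ m hm).isCompactProb hm).prob
    exact Measure.isProbabilityMeasure_map (by fun_prop)
  have hint : ∀ k, ∀ᶠ m in atTop, Integrable (fun x : ℝ => x ^ k) (η' m) := fun k => by
    filter_upwards [eventually_ge_atTop 1] with m hm
    exact integrable_pow_dilateMeasure _ (((hρ m hm).isCompactProb hm).integrable_pow k)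
  choose M hM using exists_tendsto_moment hprob fun n => ⟨_, hκ n⟩
  have hmom := moment_of_weakTendsto hprob hint hw hM
  refine ⟨fun k => (hmom k).1, fun n hn => ?_⟩
  have h1 := tendsto_nhds_unique
    (tendsto_freeCumulant (fun k => (hmom k).2 ▸ hM k) n) (hκ n)
  rw [h1, if_neg (by omega)]

end FreeProb

end

end

/-! ### The theorem -/

theorem theorem1p2
    (p : ℕ → Polynomial ℝ) (μ : Measure ℝ) [IsProbabilityMeasure μ]
    (hp : ∀ d, 1 ≤ d → FiniteFree.IsMonicNonnegRooted d (p d))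
    (hmean : ∀ d, 1 ≤ d → FiniteFree.cumulant d 1 (p d) = 1)
    (hμ : FreeProb.CompactlySupported μ)
    (hweak : FreeProb.WeakTendsto
      (fun d => FiniteFree.empiricalRootMeasure d (p d)) atTop μ)
    (hmoments : ∀ k : ℕ, Tendsto
      (fun d => FreeProb.moment (FiniteFree.empiricalRootMeasure d (p d)) k) atTop
      (𝓝 (FreeProb.moment μ k))) :
    (∀ n : ℕ, 1 ≤ n →
      Tendsto
        (fun q : ℕ × ℕ => FiniteFree.cumulant q.1 n
          (FiniteFree.dilate q.1 (1 / (q.2 : ℝ))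
            (FiniteFree.addConvPow q.1 (FiniteFree.mulConvPow q.1 (p q.1) q.2) q.2)))
        sparseRegime
        (𝓝 ((FreeProb.freeCumulant μ 2 * (n : ℝ)) ^ (n - 1) / (n.factorial : ℝ)))) ∧
    (∀ η : Measure ℝ, FreeProb.IsSakumaYoshidaLimit (FreeProb.freeCumulant μ 2) η →
      (∀ k : ℕ, Integrable (fun x : ℝ => x ^ k) η) ∧
      ∀ n : ℕ, 1 ≤ n → FreeProb.freeCumulant η n =
        (FreeProb.freeCumulant μ 2 * (n : ℝ)) ^ (n - 1) / (n.factorial : ℝ)) := by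
  have hM : ∀ k, Tendsto (fun d => FiniteFree.rootMoment d (p d) k) atTop
      (𝓝 (FreeProb.moment μ k)) := fun k => by
    simpa only [FiniteFree.moment_empiricalRootMeasure] using hmoments k
  have hmean' : ∀ d, 1 ≤ d → FiniteFree.normCoeff d (p d) 1 = 1 := fun d hd => by
    have h := hmean d hd
    rw [FiniteFree.cumulant_eq_logCumulant, FiniteFree.logCumulant_one] at h
    simpa using h
  have hκ : FreeProb.freeCumulant μ 2 = FreeProb.moment μ 2 - 1 := by
    -- Every p_d has root mean 1, so μ has mean 1 and its variance is the number M 2 - 1 of the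
    -- sparse limit.
    have h1 : FreeProb.moment μ 1 = 1 := by
      refine tendsto_nhds_unique (hM 1) (tendsto_const_nhds.congr' ?_)
      filter_upwards [(FiniteFree.smallCumulants_powerSumCoeff hp hmean' hM tendsto_id).mean]
        with d hd
      simpa using hd.symm
    rw [FreeProb.freeCumulant_two, h1, one_pow]
  refine ⟨fun n hn => ?_, fun η hη => FreeProb.sakumaYoshida_freeCumulant hη⟩
  obtain ⟨n, rfl⟩ : ∃ k, n = k + 1 := ⟨n - 1, by omega⟩
  have hprod : sparseRegime ≤ atTop ×ˢ atTop := inf_le_left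
  have h := FiniteFree.tendsto_cumulant_sparse hp hmean' hM (tendsto_fst.mono_left hprod)
    (m := Prod.snd) (tendsto_snd.mono_left hprod) (tendsto_comap.mono_left inf_le_right) n
  rw [hκ, Nat.add_sub_cancel]
  push_cast
  exact h
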